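/- Let $\mathcal L_\delta=\{0,1,+,-,\times,\delta\}$ be the language of differential rings, let $T_\delta$ be the theory of differential integral domains of characteristic zero, and let $\operatorname{DCF}_0$ be the theory of the existentially closed models of $T_\delta$, i.e. the set of all $\mathcal L_\delta$-sentences true in every existentially closed model of $T_\delta$. (1) $\operatorname{DCF}_0$ is $\omega$-stable: for every model $M\models\operatorname{DCF}_0$, every countable set of parameters $A\subseteq M$ and every $n\ge 0$, there are only countably many complete $n$-types over $A$. (2) Let $(k,\delta)$ be a differential field and let $K,K'\models\operatorname{DCF}_0$ be differential field extensions of $k$. For $a\in K$ (and likewise for elements of $K'$), let $\operatorname{tp}(a/k)$ be the set of all $\mathcal L_\delta$-formulas with parameters in $k$ that are true of $a$. Call $a$ differentially algebraic over $k$ if the sequence $(a,\delta a,\delta^2a,\dots)$ is not algebraically independent over $k$. Call $(\ell,g)$, with $\ell\ge 0$ and $g\in k[x^{(0)},\dots,x^{(\ell-1)}][t]$, a minimal polynomial datum of $a$ over $k$ if $\ell$ is least such that $\delta^\ell a$ is algebraic over $F:=k(a,\delta a,\dots,\delta^{\ell-1}a)$ and $g(a,\delta a,\dots,\delta^{\ell-1}a,t)=c\,P(t)$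 for some nonzero $c\in F$, where $P$ is the minimal polynomial of $\delta^\ell a$ over $F$. Then every $a\in K$ that is differentially algebraic over $k$ has a minimal polynomial datum over $k$; and if $(\ell,g)$ is a minimal polynomial datum of such an $a$ over $k$ and $b\in K'$, then $(\ell,g)$ is a minimal polynomial datum of $b$ over $k$ if and only if $\operatorname{tp}(a/k)=\operatorname{tp}(b/k)$. -/

import Mathlib

open FirstOrder FirstOrder.Language

universe u v w

noncomputable section

namespace DCF

/-! ### General model theory -/

/-- A literal: an atomic formula or the negation of an atomic formula. -/
def IsLiteral {L : FirstOrder.Language.{u, v}} {α : Type w} (φ : L.Formula α) : Prop :=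
  BoundedFormula.IsAtomic φ ∨ ∃ ψ : L.Formula α, BoundedFormula.IsAtomic ψ ∧ φ = ψ.not

/-- `M` is an existentially closed model of `T`: every finite system of literals in finitely many
variables with parameters from `M` (given by the left summand of `M ⊕ Fin n`) which has a solution
in some model of `T` extending `M` already has a solution in `M`. -/
def IsExistentiallyClosed {L : FirstOrder.Language.{u, v}} (T : L.Theory) (M : Type w) [L.Structure M] :
    Prop :=
  M ⊨ T ∧
    ∀ (N : Type w) [L.Structure N], N ⊨ T → ∀ (f : M ↪[L] N) (n : ℕ)
      (S : Finset (L.Formula (M ⊕ Fin n))), (∀ φ ∈ S, IsLiteral φ) →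
      (∃ y : Fin n → N, ∀ φ ∈ S, φ.Realize (Sum.elim f y)) →
      ∃ x : Fin n → M, ∀ φ ∈ S, φ.Realize (Sum.elim id x)

/-- `T` is `ω`-stable: for every model `M` of `T`, every countable set `A ⊆ M` and every `n`, there
are only countably many complete `n`-types over `A`, i.e. complete `n`-types of the theory of `M`
in the language with a constant for each element of `A`. -/
def IsOmegaStable {L : FirstOrder.Language.{u, v}} (T : L.Theory) : Prop :=
  ∀ (M : Type w) [L.Structure M], M ⊨ T → ∀ A : Set M, A.Countable →
    ∀ n : ℕ, Countable ((L[[A]].completeTheory M).CompleteType (Fin n))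

/-! ### The language of differential rings -/

/-- The function symbols `0, 1, +, -, ×, δ`. -/
inductive DiffRingFunc : ℕ → Type
  | zero : DiffRingFunc 0
  | one : DiffRingFunc 0
  | neg : DiffRingFunc 1
  | deriv : DiffRingFunc 1
  | add : DiffRingFunc 2
  | mul : DiffRingFunc 2

/-- The language of differential rings. -/
def diffRing : FirstOrder.Language where
  Functions := DiffRingFunc
  Relations := fun _ => Empty

abbrev zeroFunc : diffRing.Functions 0 := DiffRingFunc.zero
abbrev oneFunc : diffRing.Functions 0 := DiffRingFunc.one
abbrev negFunc : diffRing.Functions 1 := DiffRingFunc.neg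
abbrev derivFunc : diffRing.Functions 1 := DiffRingFunc.deriv
abbrev addFunc : diffRing.Functions 2 := DiffRingFunc.add
abbrev mulFunc : diffRing.Functions 2 := DiffRingFunc.mul

instance (α : Type u) : Zero (diffRing.Term α) := ⟨Constants.term zeroFunc⟩
instance (α : Type u) : One (diffRing.Term α) := ⟨Constants.term oneFunc⟩
instance (α : Type u) : Neg (diffRing.Term α) := ⟨negFunc.apply₁⟩
instance (α : Type u) : Add (diffRing.Term α) := ⟨addFunc.apply₂⟩
instance (α : Type u) : Mul (diffRing.Term α) := ⟨mulFunc.apply₂⟩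

/-- The term `δ t`. -/
def derivTerm {α : Type u} (t : diffRing.Term α) : diffRing.Term α := derivFunc.apply₁ t

/-- The term `0 + 1 + ⋯ + 1` with `n` ones. -/
def natTerm {α : Type u} : ℕ → diffRing.Term α
  | 0 => 0
  | n + 1 => natTerm n + 1

/-- Names of the axioms for differential integral domains of characteristic zero. -/
inductive DiffDomainAxiom : Type
  | addAssoc | addComm | zeroAdd | negAddCancel
  | mulAssoc | mulComm | oneMul | leftDistrib
  | zeroNeOne | noZeroDivisors
  | charZero (n : ℕ)
  | derivAdd | derivMul

/-- The sentence expressing each axiom. -/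
def DiffDomainAxiom.toSentence : DiffDomainAxiom → diffRing.Sentence
  | .addAssoc => ∀' ∀' ∀' (((&0 + &1) + &2) =' (&0 + (&1 + &2)))
  | .addComm => ∀' ∀' ((&0 + &1) =' (&1 + &0))
  | .zeroAdd => ∀' (((0 : diffRing.Term _) + &0) =' &0)
  | .negAddCancel => ∀' ((-&0 + &0) =' (0 : diffRing.Term _))
  | .mulAssoc => ∀' ∀' ∀' (((&0 * &1) * &2) =' (&0 * (&1 * &2)))
  | .mulComm => ∀' ∀' ((&0 * &1) =' (&1 * &0))
  | .oneMul => ∀' (((1 : diffRing.Term _) * &0) =' &0)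
  | .leftDistrib => ∀' ∀' ∀' ((&0 * (&1 + &2)) =' ((&0 * &1) + (&0 * &2)))
  | .zeroNeOne => ∼((0 : diffRing.Term _) =' 1)
  | .noZeroDivisors =>
      ∀' ∀' (((&0 * &1) =' (0 : diffRing.Term _)) ⟹
        ((&0 =' (0 : diffRing.Term _)) ⊔ (&1 =' (0 : diffRing.Term _))))
  | .charZero n => ∼(natTerm (n + 1) =' (0 : diffRing.Term _))
  | .derivAdd => ∀' ∀' (derivTerm (&0 + &1) =' (derivTerm &0 + derivTerm &1))
  | .derivMul => ∀' ∀' (derivTerm (&0 * &1) =' ((derivTerm &0 * &1) + (&0 * derivTerm &1)))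

/-- The theory of differential integral domains of characteristic zero. -/
def diffDomain : diffRing.Theory := Set.range DiffDomainAxiom.toSentence

/-- The theory of differentially closed fields of characteristic zero: the set of all sentences
true in every existentially closed differential integral domain of characteristic zero.
(Since an elementary substructure of an existentially closed model is existentially closed, and
the language is countable, restricting to models in `Type` does not change this set.) -/
def DCF0 : diffRing.Theory :=
  {φ | ∀ (M : Type) [diffRing.Structure M], IsExistentiallyClosed diffDomain M → M ⊨ φ}

/-! ### Differential fields as structures -/

/-- `R` is a structure in the language of differential rings, in which the symbols are interpreted
by the ring operations and the derivation that `R` already carries. -/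
class CompatibleDiffRing (R : Type u) [CommRing R] [Differential R] extends
    diffRing.Structure R where
  funMap_zero : ∀ x, funMap zeroFunc x = 0
  funMap_one : ∀ x, funMap oneFunc x = 1
  funMap_neg : ∀ x, funMap negFunc x = -x 0
  funMap_deriv : ∀ x, funMap derivFunc x = Differential.deriv (x 0)
  funMap_add : ∀ x, funMap addFunc x = x 0 + x 1
  funMap_mul : ∀ x, funMap mulFunc x = x 0 * x 1

/-- The complete type of `a` over `k`: all formulas in one variable with parameters from `k`
(given by the left summand of `k ⊕ Fin 1`) that are true of `a` in `K`. -/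
def tp (k : Type u) {K : Type v} [Field k] [Field K] [Algebra k K] [diffRing.Structure K] (a : K) :
    Set (diffRing.Formula (k ⊕ Fin 1)) :=
  {φ | φ.Realize (Sum.elim (algebraMap k K) fun _ => a)}

/-! ### Differentially algebraic elements -/

/-- The iterated derivative `δⁿ a`. -/
def iterDeriv {K : Type v} [Field K] [Differential K] (n : ℕ) (a : K) : K :=
  (fun x : K => Differential.deriv x)^[n] a

section

variable (k : Type u) {K : Type v} [Field k] [Field K] [Algebra k K] [Differential K]

/-- `a` is differentially algebraic over `k`: the sequence `a, δ a, δ² a, …` is not algebraically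
independent over `k`. -/
def IsDiffAlgebraic (a : K) : Prop :=
  ¬ AlgebraicIndependent k fun n : ℕ => iterDeriv n a

/-- The field `k(a, δ a, …, δ^(n-1) a)`. -/
def jetField (a : K) (n : ℕ) : IntermediateField k K :=
  IntermediateField.adjoin k (Set.range fun i : Fin n => iterDeriv i a)

/-- `(ℓ, g)` is a minimal polynomial datum for `a` over `k`: `ℓ` is the least natural number with
`δ^ℓ a` algebraic over `F = k(a, δ a, …, δ^(ℓ-1) a)`, and `g(a, δ a, …, δ^(ℓ-1) a, t)` is the
minimal polynomial of `δ^ℓ a` over `F` up to clearing denominators, i.e. up to a nonzero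
constant factor in `F`. -/
def IsMinimalDatum (a : K) (ℓ : ℕ) (g : Polynomial (MvPolynomial (Fin ℓ) k)) : Prop :=
  IsLeast {n : ℕ | IsAlgebraic (jetField k a n) (iterDeriv n a)} ℓ ∧
    ∃ c : jetField k a ℓ, c ≠ 0 ∧
      g.map (MvPolynomial.aeval fun i : Fin ℓ => iterDeriv i a : MvPolynomial (Fin ℓ) k →ₐ[k] K) =
        (Polynomial.C c * minpoly (jetField k a ℓ) (iterDeriv ℓ a)).map
          (algebraMap (jetField k a ℓ) K)

end

end DCF

end

/-!
A differential field of characteristic zero generated over a subfield `k` by one element `x` is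
determined by very little. If the derivatives `x, δ x, δ² x, …` are algebraically independent over
`k`, it is the field of fractions of the differential polynomial ring. Otherwise let `ℓ` be least
with `δ^ℓ x` algebraic over `k(x, …, δ^(ℓ-1) x)`. The lower derivatives are then independent, so the
field generated by `x, …, δ^ℓ x` is a field of rational functions with a root of one irreducible
polynomial `g` adjoined. Since this field is formally étale over the polynomial ring
`k[x₀, …, x_(ℓ-1)]`, it carries exactly one derivation with `δ xᵢ = xᵢ₊₁` extending that of `k`
(`exists_differential_of_formallyEtale`, `deriv_algHom_of_formallyEtale`). Hence it is a
differential field that embeds over `k` in every extension with an element of datum `(ℓ, g)`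
(`exists_generic_datum`), and two elements with the same datum satisfy the same atomic formulas over
`k` (`sameAtomic_of_hasCode`).

The same generic extensions show that existentially closed differential domains are fields
satisfying Blum's axioms: a differential polynomial of order `ℓ` has a zero outside the zero set of
any nonzero differential polynomial of lower order. These axioms are first order, so they hold in
all models of `DCF₀` (`exists_field_of_model`). They make the conditions defining a datum, or a
differential transcendental, finitely satisfiable, so that they are realised in an ultrapower. This
is the extension step (`exists_sameAtomic_extension`) of a back-and-forth argument showing that tuples
with the same atomic formulas satisfy the same formulas (`realize_iff_of_sameAtomic`).

The description of types by data follows at once. For `ω`-stability, a countable tuple generates a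
countable differential field, over which there are only countably many data; adding one coordinate
at a time, there are only countably many atomic types of `n`-tuples over a countable set
(`countable_atomicExtensions_inl`).
-/

noncomputable section

namespace DCF

/-! ### Differential rings as structures -/

/-- The structure in the language of differential rings carried by a differential ring. -/
@[reducible] def compatibleDiffRing (R : Type u) [CommRing R] [Differential R] :
    CompatibleDiffRing R where
  funMap f := match f with
    | .zero => fun _ => 0
    | .one => fun _ => 1
    | .neg => fun x => -x 0
    | .deriv => fun x => Differential.deriv (x 0)
    | .add => fun x => x 0 + x 1
    | .mul => fun x => x 0 * x 1
  RelMap r := r.elim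
  funMap_zero _ := rfl
  funMap_one _ := rfl
  funMap_neg _ := rfl
  funMap_deriv _ := rfl
  funMap_add _ := rfl
  funMap_mul _ := rfl

section Realize

variable {R : Type u} [CommRing R] [Differential R] [CompatibleDiffRing R] {α : Type v} (v : α → R)

@[simp] theorem realize_zero : (0 : diffRing.Term α).realize v = 0 :=
  CompatibleDiffRing.funMap_zero _

@[simp] theorem realize_one : (1 : diffRing.Term α).realize v = 1 :=
  CompatibleDiffRing.funMap_one _

@[simp] theorem realize_neg (t : diffRing.Term α) : (-t).realize v = -t.realize v :=
  CompatibleDiffRing.funMap_neg _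

@[simp] theorem realize_derivTerm (t : diffRing.Term α) :
    (derivTerm t).realize v = Differential.deriv (t.realize v) :=
  CompatibleDiffRing.funMap_deriv _

@[simp] theorem realize_add (s t : diffRing.Term α) :
    (s + t).realize v = s.realize v + t.realize v :=
  CompatibleDiffRing.funMap_add _

@[simp] theorem realize_mul (s t : diffRing.Term α) :
    (s * t).realize v = s.realize v * t.realize v :=
  CompatibleDiffRing.funMap_mul _

@[simp] theorem realize_natTerm (n : ℕ) : (natTerm n : diffRing.Term α).realize v = n := by
  induction n with
  | zero => simp [natTerm]
  | succ n ih => simp [natTerm, ih]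

end Realize

/-- Induction on terms, phrased with the ring operations on terms. -/
theorem term_induction {α : Type v} {p : diffRing.Term α → Prop} (hvar : ∀ a, p (.var a))
    (hzero : p 0) (hone : p 1) (hneg : ∀ t, p t → p (-t)) (hderiv : ∀ t, p t → p (derivTerm t))
    (hadd : ∀ s t, p s → p t → p (s + t)) (hmul : ∀ s t, p s → p t → p (s * t))
    (t : diffRing.Term α) : p t := by
  have h1 : ∀ x : Fin 1 → diffRing.Term α, x = ![x 0] := fun x => by
    ext i; fin_cases i; rfl
  have h2 : ∀ x : Fin 2 → diffRing.Term α, x = ![x 0, x 1] := fun x => by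
    ext i; fin_cases i <;> rfl
  induction t with
  | var a => exact hvar a
  | func f x ih =>
    cases f with
    | zero => rw [Subsingleton.elim x default]; exact hzero
    | one => rw [Subsingleton.elim x default]; exact hone
    | neg => rw [h1 x]; exact hneg _ (ih 0)
    | deriv => rw [h1 x]; exact hderiv _ (ih 0)
    | add => rw [h2 x]; exact hadd _ _ (ih 0) (ih 1)
    | mul => rw [h2 x]; exact hmul _ _ (ih 0) (ih 1)

/-- A ring homomorphism commuting with the derivations commutes with the evaluation of terms. -/
theorem realize_ringHom {R : Type u} {S : Type v} [CommRing R] [Differential R]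
    [CompatibleDiffRing R] [CommRing S] [Differential S] [CompatibleDiffRing S] (f : R →+* S)
    (hf : ∀ r, Differential.deriv (f r) = f (Differential.deriv r)) {α : Type w} (v : α → R)
    (t : diffRing.Term α) : t.realize (f ∘ v) = f (t.realize v) := by
  induction t using term_induction with
  | hvar a => rfl
  | hzero => simp
  | hone => simp
  | hneg t h => simp [h]
  | hderiv t h => simp [h, hf]
  | hadd s t h h' => simp [h, h']
  | hmul s t h h' => simp [h, h']

/-- An injective ring homomorphism commuting with the derivations is an embedding of structures. -/
def embeddingOfRingHom {R : Type u} {S : Type v} [CommRing R] [Differential R]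
    [CompatibleDiffRing R] [CommRing S] [Differential S] [CompatibleDiffRing S] (f : R →+* S)
    (hf : ∀ r, Differential.deriv (f r) = f (Differential.deriv r))
    (hinj : Function.Injective f) : R ↪[diffRing] S where
  toFun := f
  inj' := hinj
  map_fun' g x := by
    cases g
    · simp [CompatibleDiffRing.funMap_zero]
    · simp [CompatibleDiffRing.funMap_one]
    · simp [CompatibleDiffRing.funMap_neg]
    · simp [CompatibleDiffRing.funMap_deriv, hf]
    · simp [CompatibleDiffRing.funMap_add]
    · simp [CompatibleDiffRing.funMap_mul]
  map_rel' r := r.elim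

theorem models_diffDomain (R : Type u) [CommRing R] [IsDomain R] [CharZero R] [Differential R]
    [CompatibleDiffRing R] : R ⊨ diffDomain := by
  refine ⟨?_⟩
  rintro _ ⟨a, rfl⟩
  cases a <;>
    simp only [DiffDomainAxiom.toSentence, Sentence.Realize, Formula.Realize,
      BoundedFormula.realize_all, BoundedFormula.realize_bdEqual, BoundedFormula.realize_not,
      BoundedFormula.realize_imp, BoundedFormula.realize_sup, realize_add, realize_mul,
      realize_neg, realize_zero, realize_one, realize_derivTerm, realize_natTerm]
  · intros; ring
  · intros; ring
  · intros; ring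
  · intros; ring
  · intros; ring
  · intros; ring
  · intros; ring
  · intros; ring
  · exact zero_ne_one
  · intro x y h; exact mul_eq_zero.1 h
  · exact fun h => Nat.cast_ne_zero.2 (Nat.succ_ne_zero _) h
  · intros; simp
  · intros; simp; ring

theorem deriv_leibniz_of_map {R : Type u} [CommRing R] (d : R →+ R)
    (h : ∀ x y, d (x * y) = d x * y + x * d y) (x y : R) :
    d (x * y) = x • d y + y • d x := by
  rw [h, smul_eq_mul, smul_eq_mul]; ring

/-- A model of the theory of differential domains is a differential domain. -/
theorem exists_diffRing_of_model (M : Type u) [S : diffRing.Structure M] (h : M ⊨ diffDomain) :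
    ∃ (_ : CommRing M) (_ : Differential M) (C : CompatibleDiffRing M),
      C.toStructure = S ∧ IsDomain M ∧ CharZero M := by
  have ax : ∀ a : DiffDomainAxiom, M ⊨ a.toSentence := fun a => h.realize_of_mem _ ⟨a, rfl⟩
  let zero' : Zero M := ⟨Structure.funMap zeroFunc Fin.elim0⟩
  let one' : One M := ⟨Structure.funMap oneFunc Fin.elim0⟩
  let neg' : Neg M := ⟨fun x => Structure.funMap negFunc ![x]⟩
  let add' : Add M := ⟨fun x y => Structure.funMap addFunc ![x, y]⟩
  let mul' : Mul M := ⟨fun x y => Structure.funMap mulFunc ![x, y]⟩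
  let d : M → M := fun x => Structure.funMap derivFunc ![x]
  have r0 : ∀ (n : ℕ) (v : Empty ⊕ Fin n → M), (0 : diffRing.Term _).realize v = (0 : M) :=
    fun n v => by
      change Structure.funMap _ _ = Structure.funMap _ _
      congr 1; exact Subsingleton.elim _ _
  have r1 : ∀ (n : ℕ) (v : Empty ⊕ Fin n → M), (1 : diffRing.Term _).realize v = (1 : M) :=
    fun n v => by
      change Structure.funMap _ _ = Structure.funMap _ _
      congr 1; exact Subsingleton.elim _ _
  have h1 : ∀ x : Fin 1 → M, x = ![x 0] := fun x => by
    ext i; fin_cases i; rfl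
  have h2 : ∀ x : Fin 2 → M, x = ![x 0, x 1] := fun x => by
    ext i; fin_cases i <;> rfl
  have rn : ∀ (n : ℕ) (v : Empty ⊕ Fin n → M) (t : diffRing.Term _),
      (-t).realize v = -t.realize v := fun n v t => by
    change Structure.funMap _ _ = Structure.funMap _ _
    congr 1; rw [h1 (fun _ => _)]; rfl
  have rd : ∀ (n : ℕ) (v : Empty ⊕ Fin n → M) (t : diffRing.Term _),
      (derivTerm t).realize v = d (t.realize v) := fun n v t => by
    change Structure.funMap _ _ = Structure.funMap _ _
    congr 1; rw [h1 (fun _ => _)]; rfl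
  have ra : ∀ (n : ℕ) (v : Empty ⊕ Fin n → M) (s t : diffRing.Term _),
      (s + t).realize v = s.realize v + t.realize v := fun n v s t => by
    change Structure.funMap _ _ = Structure.funMap _ _
    congr 1; rw [h2 (fun _ => _)]; rfl
  have rm : ∀ (n : ℕ) (v : Empty ⊕ Fin n → M) (s t : diffRing.Term _),
      (s * t).realize v = s.realize v * t.realize v := fun n v s t => by
    change Structure.funMap _ _ = Structure.funMap _ _
    congr 1; rw [h2 (fun _ => _)]; rfl
  have addAssoc : ∀ x y z : M, x + y + z = x + (y + z) := by
    simpa [DiffDomainAxiom.toSentence, Sentence.Realize, Formula.Realize, r0, r1, rn, rd, ra, rm,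
      Fin.snoc] using ax .addAssoc
  have addComm : ∀ x y : M, x + y = y + x := by
    simpa [DiffDomainAxiom.toSentence, Sentence.Realize, Formula.Realize, r0, r1, rn, rd, ra, rm,
      Fin.snoc] using ax .addComm
  have zeroAdd : ∀ x : M, 0 + x = x := by
    simpa [DiffDomainAxiom.toSentence, Sentence.Realize, Formula.Realize, r0, r1, rn, rd, ra, rm,
      Fin.snoc] using ax .zeroAdd
  have negAdd : ∀ x : M, -x + x = 0 := by
    simpa [DiffDomainAxiom.toSentence, Sentence.Realize, Formula.Realize, r0, r1, rn, rd, ra, rm,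
      Fin.snoc] using ax .negAddCancel
  have mulAssoc : ∀ x y z : M, x * y * z = x * (y * z) := by
    simpa [DiffDomainAxiom.toSentence, Sentence.Realize, Formula.Realize, r0, r1, rn, rd, ra, rm,
      Fin.snoc] using ax .mulAssoc
  have mulComm : ∀ x y : M, x * y = y * x := by
    simpa [DiffDomainAxiom.toSentence, Sentence.Realize, Formula.Realize, r0, r1, rn, rd, ra, rm,
      Fin.snoc] using ax .mulComm
  have oneMul : ∀ x : M, 1 * x = x := by
    simpa [DiffDomainAxiom.toSentence, Sentence.Realize, Formula.Realize, r0, r1, rn, rd, ra, rm,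
      Fin.snoc] using ax .oneMul
  have leftDistrib : ∀ x y z : M, x * (y + z) = x * y + x * z := by
    simpa [DiffDomainAxiom.toSentence, Sentence.Realize, Formula.Realize, r0, r1, rn, rd, ra, rm,
      Fin.snoc] using ax .leftDistrib
  have derivAdd : ∀ x y : M, d (x + y) = d x + d y := by
    simpa [DiffDomainAxiom.toSentence, Sentence.Realize, Formula.Realize, r0, r1, rn, rd, ra, rm,
      Fin.snoc] using ax .derivAdd
  have derivMul : ∀ x y : M, d (x * y) = d x * y + x * d y := by
    simpa [DiffDomainAxiom.toSentence, Sentence.Realize, Formula.Realize, r0, r1, rn, rd, ra, rm,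
      Fin.snoc] using ax .derivMul
  have zeroNeOne : (0 : M) ≠ 1 := by
    simpa [DiffDomainAxiom.toSentence, Sentence.Realize, Formula.Realize, r0, r1, rn, rd, ra, rm,
      Fin.snoc] using ax .zeroNeOne
  have noZeroDiv : ∀ x y : M, x * y = 0 → x = 0 ∨ y = 0 := by
    simpa [DiffDomainAxiom.toSentence, Sentence.Realize, Formula.Realize, r0, r1, rn, rd, ra, rm,
      Fin.snoc] using ax .noZeroDivisors
  let R : CommRing M :=
    { zero', one', neg', add', mul' with
      add_assoc := addAssoc
      zero_add := zeroAdd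
      add_zero := fun a => by rw [addComm, zeroAdd]
      add_comm := addComm
      neg_add_cancel := negAdd
      mul_assoc := mulAssoc
      one_mul := oneMul
      mul_one := fun a => by rw [mulComm, oneMul]
      mul_comm := mulComm
      left_distrib := leftDistrib
      right_distrib := fun a b c => by rw [mulComm, leftDistrib, mulComm a, mulComm b]
      zero_mul := fun a => by
        have e : 0 * a + 0 * a = 0 * a := by
          rw [mulComm, ← leftDistrib, zeroAdd]
        calc 0 * a = -(0 * a) + 0 * a + 0 * a := by rw [negAdd, zeroAdd]
          _ = 0 := by rw [addAssoc, e, negAdd]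
      mul_zero := fun a => by
        have e : a * 0 + a * 0 = a * 0 := by rw [← leftDistrib, zeroAdd]
        calc a * 0 = -(a * 0) + a * 0 + a * 0 := by rw [negAdd, zeroAdd]
          _ = 0 := by rw [addAssoc, e, negAdd]
      nsmul := nsmulRec
      zsmul := zsmulRec }
  let D : Differential M :=
    ⟨Derivation.mk' (AddMonoidHom.mk' d derivAdd).toIntLinearMap
      (deriv_leibniz_of_map (AddMonoidHom.mk' d derivAdd) derivMul)⟩
  let C : CompatibleDiffRing M :=
    { S with
      funMap_zero := fun x => by rw [Subsingleton.elim x Fin.elim0]; rfl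
      funMap_one := fun x => by rw [Subsingleton.elim x Fin.elim0]; rfl
      funMap_neg := fun x => by rw [h1 x]; rfl
      funMap_deriv := fun x => by rw [h1 x]; rfl
      funMap_add := fun x => by rw [h2 x]; rfl
      funMap_mul := fun x => by rw [h2 x]; rfl }
  have : Nontrivial M := ⟨0, 1, zeroNeOne⟩
  have : NoZeroDivisors M := ⟨fun {a b} => noZeroDiv a b⟩
  refine ⟨R, D, C, rfl, NoZeroDivisors.to_isDomain M, charZero_of_inj_zero fun n hn => ?_⟩
  cases n with
  | zero => rfl
  | succ n =>
    have := ax (.charZero n)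
    simp only [DiffDomainAxiom.toSentence, Sentence.Realize, Formula.Realize,
      BoundedFormula.realize_not, BoundedFormula.realize_bdEqual] at this
    refine absurd ?_ this
    refine (realize_natTerm (R := M) _ _).trans (Eq.trans hn ?_)
    exact (realize_zero (R := M) _).symm

/-! ### Extending derivations -/

/-- A derivation on a polynomial ring with values in an algebra over it can be prescribed on the
coefficients, where it extends a given derivation, and on the variables. It is the second component
of a ring homomorphism to the dual numbers. It is stated as an additive map, since elaboration finds
two forms of the `ℤ`-algebra structure of `MvPolynomial`. -/
theorem exists_derivation_mvPolynomial {ι : Type v} {k : Type u} {L : Type w} [CommRing k]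
    [Differential k] [CommRing L] [Algebra (MvPolynomial ι k) L] (y : ι → L) :
    ∃ d : MvPolynomial ι k →+ L, (∀ p q, d (p * q) = p • d q + q • d p) ∧
      (∀ c, d (MvPolynomial.C c) =
        algebraMap (MvPolynomial ι k) L (MvPolynomial.C (Differential.deriv c))) ∧
      ∀ i, d (MvPolynomial.X i) = y i := by
  let φ₀ : k →+* L := (algebraMap (MvPolynomial ι k) L).comp MvPolynomial.C
  let κ : k →+* TrivSqZeroExt L L :=
    { toFun := fun c => TrivSqZeroExt.inl (φ₀ c) + TrivSqZeroExt.inr (φ₀ (Differential.deriv c))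
      map_one' := by ext <;> simp
      map_zero' := by ext <;> simp
      map_mul' := fun a b => by ext <;> simp [mul_comm]
      map_add' := fun a b => by ext <;> simp }
  let φ : MvPolynomial ι k →+* TrivSqZeroExt L L :=
    MvPolynomial.eval₂Hom κ fun i =>
      TrivSqZeroExt.inl (algebraMap (MvPolynomial ι k) L (MvPolynomial.X i)) +
        TrivSqZeroExt.inr (y i)
  have hfst : ∀ p, (φ p).fst = algebraMap (MvPolynomial ι k) L p := fun p => by
    have : ((TrivSqZeroExt.fstHom L L L).toRingHom.comp φ) = algebraMap (MvPolynomial ι k) L := by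
      apply MvPolynomial.ringHom_ext
      · intro c; simp [φ, κ, φ₀]
      · intro i; simp [φ]
    exact congrArg (fun f => f p) this
  refine ⟨AddMonoidHom.mk' (fun p => (φ p).snd) fun p q => ?_, ?_,
    fun c => ?_, fun i => ?_⟩
  · rw [map_add, TrivSqZeroExt.snd_add]
  · intro p q
    change (φ (p * q)).snd = p • (φ q).snd + q • (φ p).snd
    rw [map_mul, TrivSqZeroExt.snd_mul, hfst, hfst]
    simp only [Algebra.smul_def p, Algebra.smul_def q, MulOpposite.smul_eq_mul_unop,
      MulOpposite.unop_op, smul_eq_mul]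
    ring
  · change (φ _).snd = _
    rw [show φ (MvPolynomial.C c) = κ c from MvPolynomial.eval₂Hom_C _ _ _]
    change TrivSqZeroExt.snd (TrivSqZeroExt.inl (φ₀ c) +
      TrivSqZeroExt.inr (φ₀ (Differential.deriv c)) : TrivSqZeroExt L L) = _
    rw [TrivSqZeroExt.snd_add, TrivSqZeroExt.snd_inl, TrivSqZeroExt.snd_inr, zero_add]
    rfl
  · change (φ _).snd = _
    simp [φ]

open TensorProduct in
/-- Derivations extend along formally étale algebras, because these do not change the module of
Kähler differentials. -/
theorem exists_derivation_extension {A : Type u} {L : Type v} [CommRing A] [CommRing L]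
    [Algebra A L] [Algebra.FormallyEtale A L] (d₀ : A →+ L)
    (h : ∀ p q, d₀ (p * q) = p • d₀ q + q • d₀ p) :
    ∃ D : Derivation ℤ L L, ∀ a, D (algebraMap A L a) = d₀ a := by
  let d : Derivation ℤ A L := Derivation.mk' d₀.toIntLinearMap h
  let e := KaehlerDifferential.tensorKaehlerEquivOfFormallyEtale ℤ A L
  let f : Ω[L⁄ℤ] →ₗ[L] L := (d.liftKaehlerDifferential.liftBaseChange L).comp e.symm.toLinearMap
  refine ⟨f.compDer (KaehlerDifferential.D ℤ L), fun a => ?_⟩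
  change (d.liftKaehlerDifferential.liftBaseChange L) (e.symm
    (KaehlerDifferential.D ℤ L (algebraMap A L a))) = _
  rw [show e.symm (KaehlerDifferential.D ℤ L (algebraMap A L a)) =
      1 ⊗ₜ[A] KaehlerDifferential.D ℤ A a from
    KaehlerDifferential.tensorKaehlerEquivOfFormallyEtale_symm_D_algebraMap ℤ A L a]
  rw [LinearMap.liftBaseChange_tmul, one_smul, Derivation.liftKaehlerDifferential_comp_D]
  rfl

/-- A ring homomorphism out of a formally unramified `A`-algebra commutes with the derivations as
soon as it does so on the image of `A`. -/
theorem deriv_ringHom_of_formallyUnramified {A : Type u} {L : Type v} {K : Type w} [CommRing A]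
    [CommRing L] [CommRing K] [Differential L] [Differential K] [Algebra A L]
    [Algebra.FormallyUnramified A L] (σ : L →+* K)
    (h : ∀ a, Differential.deriv (σ (algebraMap A L a)) =
      σ (Differential.deriv (algebraMap A L a))) (l : L) :
    Differential.deriv (σ l) = σ (Differential.deriv l) := by
  let _ : Algebra L K := σ.toAlgebra
  let _ : Algebra A K := (σ.comp (algebraMap A L)).toAlgebra
  have : IsScalarTower A L K := IsScalarTower.of_algebraMap_eq fun _ => rfl
  have hmul : ∀ x y : L, Differential.deriv (σ (x * y)) - σ (Differential.deriv (x * y)) =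
      σ x * (Differential.deriv (σ y) - σ (Differential.deriv y)) +
        σ y * (Differential.deriv (σ x) - σ (Differential.deriv x)) := fun x y => by
    simp only [map_mul, Derivation.leibniz, smul_eq_mul, map_add]
    ring
  let E : Derivation A L K := Derivation.mk'
    { toFun := fun x => Differential.deriv (σ x) - σ (Differential.deriv x)
      map_add' := fun x y => by simp only [map_add]; ring
      map_smul' := fun a x => by
        rw [Algebra.smul_def, hmul, h, sub_self, mul_zero, add_zero]
        rfl }
    fun x y => hmul x y
  -- `E` is an `A`-derivation, so it factors through `Ω[L⁄A] = 0`.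
  have hE : E l = 0 := by
    rw [← E.liftKaehlerDifferential_comp_D l,
      Subsingleton.elim (KaehlerDifferential.D A L l) 0, map_zero]
  exact sub_eq_zero.1 hE

/-- If `L` is formally étale over a polynomial ring over the differential ring `k`, then the
derivation of `k` extends to `L` with arbitrary values on the variables. -/
theorem exists_differential_of_formallyEtale {ι : Type v} {k : Type u} {L : Type w} [CommRing k]
    [Differential k] [CommRing L] [Algebra k L] [Algebra (MvPolynomial ι k) L]
    [IsScalarTower k (MvPolynomial ι k) L] [Algebra.FormallyEtale (MvPolynomial ι k) L]
    (y : ι → L) :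
    ∃ _ : Differential L, DifferentialAlgebra k L ∧
      ∀ i, Differential.deriv (algebraMap (MvPolynomial ι k) L (MvPolynomial.X i)) = y i := by
  obtain ⟨d, h, hd, hd'⟩ := exists_derivation_mvPolynomial (k := k) y
  obtain ⟨D, hD⟩ := exists_derivation_extension d h
  let _ : Differential L := ⟨D⟩
  refine ⟨⟨D⟩, ⟨fun c => ?_⟩, fun i => ?_⟩
  · change D _ = _
    rw [IsScalarTower.algebraMap_apply k (MvPolynomial ι k) L, MvPolynomial.algebraMap_eq, hD, hd,
      IsScalarTower.algebraMap_apply k (MvPolynomial ι k) L, MvPolynomial.algebraMap_eq]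
  · change D _ = _
    rw [hD, hd']

/-- A homomorphism over `k` out of a formally étale algebra over a polynomial ring over `k` commutes
with the derivations as soon as it does so on the variables. -/
theorem deriv_algHom_of_formallyEtale {ι : Type v} {k : Type u} {L : Type w} {K : Type*}
    [CommRing k] [Differential k] [CommRing L] [Differential L] [Algebra k L]
    [DifferentialAlgebra k L] [Algebra (MvPolynomial ι k) L]
    [IsScalarTower k (MvPolynomial ι k) L] [Algebra.FormallyEtale (MvPolynomial ι k) L]
    [CommRing K] [Differential K] [Algebra k K] [DifferentialAlgebra k K] (σ : L →ₐ[k] K)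
    (h : ∀ i, Differential.deriv (σ (algebraMap (MvPolynomial ι k) L (MvPolynomial.X i))) =
      σ (Differential.deriv (algebraMap (MvPolynomial ι k) L (MvPolynomial.X i)))) (l : L) :
    Differential.deriv (σ l) = σ (Differential.deriv l) := by
  refine deriv_ringHom_of_formallyUnramified (A := MvPolynomial ι k) σ.toRingHom (fun p => ?_) l
  change Differential.deriv (σ _) = σ _
  induction p using MvPolynomial.induction_on with
  | C c =>
    rw [← MvPolynomial.algebraMap_eq, ← IsScalarTower.algebraMap_apply k (MvPolynomial ι k) L,
      σ.commutes, DifferentialAlgebra.deriv_algebraMap, DifferentialAlgebra.deriv_algebraMap,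
      σ.commutes]
  | add p q hp hq => simp only [map_add, hp, hq]
  | mul_X p i hp =>
    simp only [map_mul, Derivation.leibniz, smul_eq_mul, map_add, hp, h]

/-! ### Minimal polynomial data -/

section Datum

variable {k : Type u} [Field k] {K : Type v} [Field K] [Algebra k K] [Differential K]

variable (k) in
/-- The elements `x, δ x, …, δ^(n-1) x` are algebraically independent over `k`. -/
def JetIndependent (x : K) (n : ℕ) : Prop :=
  AlgebraicIndependent k fun i : Fin n => iterDeriv i x

variable (k) in
/-- Evaluation of polynomials in `n` variables at the jet `(x, δ x, …, δ^(n-1) x)`. -/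
abbrev evalJet (x : K) (n : ℕ) : MvPolynomial (Fin n) k →ₐ[k] K :=
  MvPolynomial.aeval fun i : Fin n => iterDeriv i x

/-- The polynomial `g` regarded over the field of rational functions. -/
abbrev genericPoly {ℓ : ℕ} (g : Polynomial (MvPolynomial (Fin ℓ) k)) :
    Polynomial (FractionRing (MvPolynomial (Fin ℓ) k)) :=
  g.map (algebraMap (MvPolynomial (Fin ℓ) k) (FractionRing (MvPolynomial (Fin ℓ) k)))

variable (k) in
/-- A reformulation of `IsMinimalDatum` in which the only conditions on `x` are that
`x, …, δ^(ℓ-1) x` are algebraically independent and that `δ^ℓ x` is a root of `g`; the remaining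
condition, irreducibility over the field of rational functions, concerns only `g`. -/
def HasDatum (x : K) (ℓ : ℕ) (g : Polynomial (MvPolynomial (Fin ℓ) k)) : Prop :=
  JetIndependent k x ℓ ∧ Irreducible (genericPoly g) ∧
    (g.map (evalJet k x ℓ : MvPolynomial (Fin ℓ) k →+* K)).eval (iterDeriv ℓ x) = 0

open scoped IntermediateField.algebraAdjoinAdjoin in
theorem jetIndependent_succ_iff (x : K) (n : ℕ) :
    JetIndependent k x (n + 1) ↔
      JetIndependent k x n ∧ ¬ IsAlgebraic (jetField k x n) (iterDeriv n x) := by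
  have h : (fun i : Fin (n + 1) => iterDeriv (i : ℕ) x) =
      (fun o : Option (Fin n) => o.elim (iterDeriv n x) fun i => iterDeriv (i : ℕ) x) ∘
        finSuccEquivLast := by
    funext i
    refine Fin.lastCases ?_ (fun j => ?_) i <;> simp
  rw [JetIndependent, h, algebraicIndependent_equiv, AlgebraicIndependent.option_iff,
    JetIndependent, Transcendental, jetField, IsFractionRing.isAlgebraic_iff
      (Algebra.adjoin k (Set.range fun i : Fin n => iterDeriv (i : ℕ) x))
      (IntermediateField.adjoin k (Set.range fun i : Fin n => iterDeriv (i : ℕ) x)) K]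

theorem jetIndependent_iff (x : K) (n : ℕ) :
    JetIndependent k x n ↔ ∀ m < n, ¬ IsAlgebraic (jetField k x m) (iterDeriv m x) := by
  induction n with
  | zero =>
    simp only [Nat.not_lt_zero, false_imp_iff, implies_true, iff_true]
    exact algebraicIndependent_empty_type_iff.2 (algebraMap k K).injective
  | succ n ih => rw [jetIndependent_succ_iff, ih, Nat.forall_lt_succ_right]

theorem algebraicIndependent_iff_forall_jetIndependent (x : K) :
    AlgebraicIndependent k (fun n : ℕ => iterDeriv n x) ↔ ∀ n, JetIndependent k x n := by
  refine ⟨fun h n => h.comp _ Fin.val_injective, fun h => ?_⟩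
  refine algebraicIndependent_of_finite_type fun t ht => ?_
  obtain ⟨n, hn⟩ := ht.bddAbove
  exact (h (n + 1)).comp (fun i : t => (⟨i, Nat.lt_succ_of_le (hn i.2)⟩ : Fin (n + 1)))
    fun i j hij => Subtype.ext (by simpa using hij)

/-- The field of rational functions is the field generated by a free jet. -/
def jetEquiv {x : K} {n : ℕ} (h : JetIndependent k x n) :
    FractionRing (MvPolynomial (Fin n) k) ≃ₐ[k] jetField k x n :=
  AlgebraicIndependent.aevalEquivField h

theorem jetEquiv_algebraMap {x : K} {n : ℕ} (h : JetIndependent k x n)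
    (p : MvPolynomial (Fin n) k) : (jetEquiv h (algebraMap _ _ p) : K) = evalJet k x n p :=
  AlgebraicIndependent.aevalEquivField_algebraMap_apply_coe h p

theorem map_jetEquiv {x : K} {n : ℕ} (h : JetIndependent k x n)
    (g : Polynomial (MvPolynomial (Fin n) k)) :
    ((genericPoly g).map (jetEquiv h : _ →+* jetField k x n)).map (algebraMap (jetField k x n) K) =
      g.map (evalJet k x n : MvPolynomial (Fin n) k →+* K) := by
  rw [genericPoly, Polynomial.map_map, Polynomial.map_map]
  congr 1
  exact RingHom.ext fun p => jetEquiv_algebraMap h p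

theorem irreducible_map_iff {F E : Type*} [Field F] [Field E] (e : F ≃+* E) (p : Polynomial F) :
    Irreducible (p.map (e : F →+* E)) ↔ Irreducible p :=
  MulEquiv.irreducible_iff (Polynomial.mapEquiv e)

/-- Up to a nonzero constant, the minimal polynomial is the only irreducible annihilator. -/
theorem exists_eq_C_mul_minpoly_iff {F E : Type*} [Field F] [Field E] [Algebra F E] {y : E}
    {p : Polynomial F} (hy : IsAlgebraic F y) :
    (∃ c : F, c ≠ 0 ∧ p = Polynomial.C c * minpoly F y) ↔
      Irreducible p ∧ Polynomial.aeval y p = 0 := by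
  constructor
  · rintro ⟨c, hc, rfl⟩
    refine ⟨?_, by simp⟩
    rw [irreducible_isUnit_mul (Polynomial.isUnit_C.2 hc.isUnit)]
    exact minpoly.irreducible hy.isIntegral
  · rintro ⟨hp, h0⟩
    obtain ⟨q, rfl⟩ := minpoly.dvd F y h0
    obtain ⟨c, hc, rfl⟩ := Polynomial.isUnit_iff.1
      ((hp.isUnit_or_isUnit rfl).resolve_left (minpoly.not_isUnit F y))
    exact ⟨c, hc.ne_zero, mul_comm _ _⟩

theorem isMinimalDatum_iff_hasDatum (x : K) (ℓ : ℕ) (g : Polynomial (MvPolynomial (Fin ℓ) k)) :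
    IsMinimalDatum k x ℓ g ↔ HasDatum k x ℓ g := by
  have hleast : IsLeast {n : ℕ | IsAlgebraic (jetField k x n) (iterDeriv n x)} ℓ ↔
      IsAlgebraic (jetField k x ℓ) (iterDeriv ℓ x) ∧ JetIndependent k x ℓ := by
    rw [jetIndependent_iff]
    refine and_congr Iff.rfl ⟨fun h m hm hm' => (h hm').not_gt hm, fun h m hm => ?_⟩
    by_contra! hlt
    exact h m hlt hm
  rw [IsMinimalDatum, hleast, HasDatum]
  have key : ∀ h : JetIndependent k x ℓ, ∀ halg : IsAlgebraic (jetField k x ℓ) (iterDeriv ℓ x),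
      (∃ c : jetField k x ℓ, c ≠ 0 ∧
        g.map (evalJet k x ℓ : MvPolynomial (Fin ℓ) k →+* K) =
          (Polynomial.C c * minpoly (jetField k x ℓ) (iterDeriv ℓ x)).map
            (algebraMap (jetField k x ℓ) K)) ↔
      Irreducible (genericPoly g) ∧
        (g.map (evalJet k x ℓ : MvPolynomial (Fin ℓ) k →+* K)).eval (iterDeriv ℓ x) = 0 := by
    intro h halg
    rw [← irreducible_map_iff (jetEquiv h).toRingEquiv, ← map_jetEquiv h,
      Polynomial.eval_map_algebraMap]
    refine Iff.trans (exists_congr fun c => and_congr Iff.rfl ?_)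
      (exists_eq_C_mul_minpoly_iff halg
        (p := (genericPoly g).map (jetEquiv h : _ →+* jetField k x ℓ)))
    exact (Polynomial.map_injective _ (algebraMap (jetField k x ℓ) K).injective).eq_iff
  constructor
  · rintro ⟨⟨halg, h⟩, hc⟩
    exact ⟨h, (key h halg).1 hc⟩
  · rintro ⟨h, hirr, h0⟩
    have halg : IsAlgebraic (jetField k x ℓ) (iterDeriv ℓ x) := by
      refine ⟨(genericPoly g).map (jetEquiv h : _ →+* jetField k x ℓ), ?_, ?_⟩
      · exact (Polynomial.map_ne_zero_iff (jetEquiv h).injective).2 hirr.ne_zero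
      · rw [← Polynomial.eval_map_algebraMap, map_jetEquiv, h0]
    exact ⟨⟨halg, h⟩, (key h halg).2 ⟨hirr, h0⟩⟩

/-- Clearing denominators in a polynomial over a fraction field. -/
theorem exists_map_eq_C_mul {A : Type u} {F : Type v} [CommRing A] [IsDomain A] [Field F]
    [Algebra A F] [IsFractionRing A F] (p : Polynomial F) :
    ∃ g : Polynomial A, ∃ c : F, c ≠ 0 ∧ g.map (algebraMap A F) = Polynomial.C c * p := by
  obtain ⟨b, hb, h⟩ := IsLocalization.integerNormalization_spec (nonZeroDivisors A) p
  refine ⟨_, algebraMap A F b, IsFractionRing.to_map_ne_zero_of_mem_nonZeroDivisors hb, h.trans ?_⟩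
  rw [Algebra.smul_def]
  rfl

/-- A differentially algebraic element has a minimal polynomial datum. -/
theorem exists_hasDatum {x : K} (h : IsDiffAlgebraic k x) : ∃ ℓ g, HasDatum k x ℓ g := by
  classical
  rw [IsDiffAlgebraic, algebraicIndependent_iff_forall_jetIndependent] at h
  have hex : ∃ n, IsAlgebraic (jetField k x n) (iterDeriv n x) := by
    by_contra! hno
    exact h fun n => (jetIndependent_iff x n).2 fun m _ => hno m
  have hind : JetIndependent k x (Nat.find hex) :=
    (jetIndependent_iff x _).2 fun m hm => Nat.find_min hex hm
  have halg := Nat.find_spec hex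
  generalize Nat.find hex = ℓ at hind halg
  obtain ⟨g, c, hc, hg⟩ := exists_map_eq_C_mul (A := MvPolynomial (Fin ℓ) k)
    ((minpoly (jetField k x ℓ) (iterDeriv ℓ x)).map
      ((jetEquiv hind).symm : jetField k x ℓ →+* FractionRing (MvPolynomial (Fin ℓ) k)))
  have hmap : (genericPoly g).map (jetEquiv hind : _ →+* jetField k x ℓ) =
      Polynomial.C (jetEquiv hind c) * minpoly (jetField k x ℓ) (iterDeriv ℓ x) := by
    rw [genericPoly, hg, Polynomial.map_mul, Polynomial.map_C, Polynomial.map_map]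
    congr 1
    convert Polynomial.map_id using 2
    exact RingHom.ext fun y => (jetEquiv hind).apply_symm_apply y
  refine ⟨ℓ, g, (isMinimalDatum_iff_hasDatum x ℓ g).1
    ⟨⟨halg, fun m hm => ?_⟩, jetEquiv hind c, ?_, ?_⟩⟩
  · by_contra! hlt
    exact (jetIndependent_iff x ℓ).1 hind m hlt hm
  · simpa using hc
  · rw [← hmap, map_jetEquiv]

end Datum

/-! ### Generic extensions -/

section Generic

variable (k : Type u) [Field k] [Differential k]

theorem iterDeriv_succ {K : Type v} [Field K] [Differential K] (n : ℕ) (x : K) :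
    iterDeriv (n + 1) x = Differential.deriv (iterDeriv n x) :=
  Function.iterate_succ_apply' _ _ _

/-- For every element `x` with the property `p` of a differential field extension `K` of `k`, there
is a differential embedding of `L` into `K` over `k` that sends `x₀` to `x`. -/
def EmbedsInto (L : Type u) [Field L] [Differential L] [Algebra k L] (x₀ : L)
    (p : ∀ (K : Type u) [Field K] [Differential K] [Algebra k K], K → Prop) : Prop :=
  ∀ (K : Type u) [Field K] [Differential K] [Algebra k K] [DifferentialAlgebra k K] (x : K),
    p K x → ∃ σ : L →ₐ[k] K,
      (∀ y, Differential.deriv (σ y) = σ (Differential.deriv y)) ∧ σ x₀ = x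

/-- There is a generic differential transcendental: the variable `x₀` of the field of fractions of
the differential polynomial ring `k[x₀, x₁, …]`, `δ xᵢ = xᵢ₊₁`. -/
theorem exists_generic_transcendental :
    ∃ (L : Type u) (_ : Field L) (_ : Differential L) (_ : Algebra k L)
      (_ : DifferentialAlgebra k L) (x₀ : L),
      EmbedsInto k L x₀ fun _ _ _ _ x => AlgebraicIndependent k fun n : ℕ => iterDeriv n x := by
  let A := MvPolynomial ℕ k
  let L := FractionRing A
  have : Algebra.FormallyEtale A L := .of_isLocalization (nonZeroDivisors A)
  let X (n : ℕ) : L := algebraMap A L (MvPolynomial.X n)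
  obtain ⟨D, hD, hX⟩ := exists_differential_of_formallyEtale (k := k) (L := L) fun n => X (n + 1)
  refine ⟨L, inferInstance, D, inferInstance, hD, X 0, ?_⟩
  intro K _ _ _ _ x hx
  have hinj : Function.Injective (MvPolynomial.aeval (fun n : ℕ => iterDeriv n x) : A →ₐ[k] K) :=
    algebraicIndependent_iff_injective_aeval.1 hx
  let σ : L →ₐ[k] K := IsFractionRing.liftAlgHom hinj
  have hσ : ∀ n, σ (X n) = iterDeriv n x := fun n =>
    (IsFractionRing.lift_algebraMap (K := L) hinj (MvPolynomial.X n)).trans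
      (MvPolynomial.aeval_X _ _)
  refine ⟨σ, fun y => deriv_algHom_of_formallyEtale (ι := ℕ) σ (fun n => ?_) y, hσ 0⟩
  rw [hX]
  change Differential.deriv (σ (X n)) = σ (X (n + 1))
  rw [hσ, hσ, iterDeriv_succ]

variable {k}

/-- There is a generic element with a given minimal polynomial datum `(ℓ, g)`: adjoin to the field
of rational functions `k(x₀, …, x_(ℓ-1))` a root `x_ℓ` of `g`, and put `δ xᵢ = xᵢ₊₁`. The derivation
extends uniquely to `x_ℓ` by separability. -/
theorem exists_generic_datum [CharZero k] {ℓ : ℕ} {g : Polynomial (MvPolynomial (Fin ℓ) k)}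
    (hg : Irreducible (genericPoly g)) :
    ∃ (L : Type u) (_ : Field L) (_ : Differential L) (_ : Algebra k L)
      (_ : DifferentialAlgebra k L) (x₀ : L), HasDatum k x₀ ℓ g ∧
      EmbedsInto k L x₀ fun _ _ _ _ x => HasDatum k x ℓ g := by
  let A := MvPolynomial (Fin ℓ) k
  let F := FractionRing A
  have : Fact (Irreducible (genericPoly g)) := ⟨hg⟩
  let L := AdjoinRoot (genericPoly g)
  have hAF : Algebra.FormallyEtale A F := .of_isLocalization (nonZeroDivisors A)
  have hfin : Module.Finite F L := (AdjoinRoot.powerBasis hg.ne_zero).finite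
  have hchar : CharZero F := IsFractionRing.charZero A
  have hFL : Algebra.FormallyEtale F L := .of_isSeparable F L
  have : Algebra.FormallyEtale A L := .comp A F L
  -- The jet of the generic element, whose last entry is the adjoined root. For `ℓ = 0` the generic
  -- element `X 0` is this root itself.
  let X : Fin (ℓ + 1) → L :=
    Fin.snoc (fun i => algebraMap A L (MvPolynomial.X i)) (AdjoinRoot.root (genericPoly g))
  have hXc : ∀ i : Fin ℓ, X i.castSucc = algebraMap A L (MvPolynomial.X i) := fun i => by simp [X]
  have hXl : X (Fin.last ℓ) = AdjoinRoot.root (genericPoly g) := by simp [X]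
  obtain ⟨D, hD, hX⟩ := exists_differential_of_formallyEtale (k := k) (L := L)
    fun i : Fin ℓ => X i.succ
  have hiter : ∀ i : Fin (ℓ + 1), iterDeriv (i : ℕ) (X 0) = X i := by
    intro i
    induction i using Fin.induction with
    | zero => rfl
    | succ i ih =>
      rw [Fin.val_castSucc] at ih
      rw [Fin.val_succ, iterDeriv_succ, ih, hXc, hX]
  have heval : evalJet k (X 0) ℓ = IsScalarTower.toAlgHom k A L := by
    refine MvPolynomial.algHom_ext fun i => ?_
    rw [MvPolynomial.aeval_X]
    exact (hiter i.castSucc).trans (hXc i)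
  refine ⟨L, inferInstance, D, inferInstance, hD, X 0, ⟨?_, hg, ?_⟩, ?_⟩
  · refine algebraicIndependent_iff_injective_aeval.2 ?_
    change Function.Injective (evalJet k (X 0) ℓ)
    rw [heval]
    change Function.Injective (algebraMap A L)
    rw [IsScalarTower.algebraMap_eq A F L]
    exact (algebraMap F L).injective.comp (IsFractionRing.injective A F)
  · have h1 := hiter (Fin.last ℓ)
    rw [Fin.val_last, hXl] at h1
    rw [heval, h1]
    change (g.map (algebraMap A L)).eval _ = 0
    rw [IsScalarTower.algebraMap_eq A F L, ← Polynomial.map_map, Polynomial.eval_map]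
    exact AdjoinRoot.eval₂_root (genericPoly g)
  · intro K _ _ _ _ x hx
    have hinj : Function.Injective (evalJet k x ℓ) :=
      algebraicIndependent_iff_injective_aeval.1 hx.1
    let τ : F →ₐ[k] K := IsFractionRing.liftAlgHom hinj
    have hτ : ∀ a : A, τ (algebraMap A F a) = evalJet k x ℓ a := fun a =>
      IsFractionRing.lift_algebraMap (K := F) hinj a
    have hroot : (genericPoly g).eval₂ (τ : F →+* K) (iterDeriv ℓ x) = 0 := by
      rw [← Polynomial.eval_map, genericPoly, Polynomial.map_map, ← hx.2.2]
      congr 2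
      exact RingHom.ext hτ
    let σ₀ : L →+* K := AdjoinRoot.lift (τ : F →+* K) (iterDeriv ℓ x) hroot
    have hσ₀ : ∀ a : A, σ₀ (algebraMap A L a) = evalJet k x ℓ a := fun a => by
      rw [IsScalarTower.algebraMap_apply A F L, ← hτ]
      exact AdjoinRoot.lift_of hroot
    let σ : L →ₐ[k] K := { σ₀ with
      commutes' := fun c => by
        change σ₀ (algebraMap k L c) = _
        rw [IsScalarTower.algebraMap_apply k A L, hσ₀]
        exact (evalJet k x ℓ).commutes c }
    have hσ : ∀ i, σ (X i) = iterDeriv (i : ℕ) x := by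
      intro i
      induction i using Fin.lastCases with
      | last => rw [hXl]; exact AdjoinRoot.lift_root hroot
      | cast i =>
        rw [hXc]
        exact (hσ₀ _).trans (MvPolynomial.aeval_X _ _)
    refine ⟨σ, fun y => deriv_algHom_of_formallyEtale (ι := Fin ℓ) σ (fun i => ?_) y, hσ 0⟩
    rw [hX, ← hXc, hσ, hσ, Fin.val_succ, iterDeriv_succ, Fin.val_castSucc]

end Generic

/-! ### Terms for polynomials -/

section Terms

variable {α : Type u} {β : Type v}

/-- The sum of a list of terms. -/
def sumTerm (l : List (diffRing.Term α)) : diffRing.Term α := l.foldr (· + ·) 0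

/-- The product of a list of terms. -/
def prodTerm (l : List (diffRing.Term α)) : diffRing.Term α := l.foldr (· * ·) 1

/-- The term for an integer. -/
def intTerm : ℤ → diffRing.Term α
  | .ofNat n => natTerm n
  | .negSucc n => -natTerm (n + 1)

/-- The term for the value of an integer polynomial at a family of terms. -/
def polyTerm (τ : β → diffRing.Term α) (p : MvPolynomial β ℤ) : diffRing.Term α :=
  sumTerm (p.support.toList.map fun m => intTerm (p.coeff m) *
    prodTerm (m.support.toList.map fun b => prodTerm (List.replicate (m b) (τ b))))

/-- The term for the value at `t` of a polynomial in one variable, after its coefficients have been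
evaluated at a family of terms. -/
def polyTermAt (τ : β → diffRing.Term α) (t : diffRing.Term α)
    (f : Polynomial (MvPolynomial β ℤ)) : diffRing.Term α :=
  sumTerm (f.support.toList.map fun j => polyTerm τ (f.coeff j) * prodTerm (List.replicate j t))

/-- The term `δⁿ t`. -/
def iterDerivTerm (n : ℕ) (t : diffRing.Term α) : diffRing.Term α := derivTerm^[n] t

variable {R : Type w} [CommRing R] [Differential R] [CompatibleDiffRing R] (v : α → R)

theorem realize_sumTerm (l : List (diffRing.Term α)) :
    (sumTerm l).realize v = (l.map fun t => t.realize v).sum := by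
  induction l with
  | nil => exact realize_zero v
  | cons t l ih => exact (realize_add v t (sumTerm l)).trans (by rw [ih]; simp)

theorem realize_prodTerm (l : List (diffRing.Term α)) :
    (prodTerm l).realize v = (l.map fun t => t.realize v).prod := by
  induction l with
  | nil => exact realize_one v
  | cons t l ih => exact (realize_mul v t (prodTerm l)).trans (by rw [ih]; simp)

theorem realize_intTerm (n : ℤ) : (intTerm n : diffRing.Term α).realize v = n := by
  cases n with
  | ofNat n => simp [intTerm]
  | negSucc n => simp [intTerm]

theorem realize_polyTerm (τ : β → diffRing.Term α) (p : MvPolynomial β ℤ) :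
    (polyTerm τ p).realize v = MvPolynomial.aeval (fun b => (τ b).realize v) p := by
  simp only [polyTerm, realize_sumTerm, List.map_map, Function.comp_def, realize_mul,
    realize_intTerm, realize_prodTerm, List.map_replicate, List.prod_replicate,
    Finset.prod_map_toList, Finset.sum_map_toList]
  rw [MvPolynomial.aeval_def, MvPolynomial.eval₂_eq]
  simp

theorem realize_polyTermAt (τ : β → diffRing.Term α) (t : diffRing.Term α)
    (f : Polynomial (MvPolynomial β ℤ)) :
    (polyTermAt τ t f).realize v =
      f.eval₂ (MvPolynomial.aeval (fun b => (τ b).realize v) : MvPolynomial β ℤ →ₐ[ℤ] R)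
        (t.realize v) := by
  simp only [polyTermAt, realize_sumTerm, List.map_map, Function.comp_def, realize_mul,
    realize_polyTerm, realize_prodTerm, List.map_replicate, List.prod_replicate,
    Finset.sum_map_toList]
  rw [Polynomial.eval₂_eq_sum, Polynomial.sum_def]
  simp

end Terms

theorem realize_iterDerivTerm {α : Type u} {K : Type w} [Field K] [Differential K]
    [CompatibleDiffRing K] (v : α → K) (n : ℕ) (t : diffRing.Term α) :
    (iterDerivTerm n t).realize v = iterDeriv n (t.realize v) := by
  induction n with
  | zero => rfl
  | succ n ih =>
    rw [iterDeriv_succ, ← ih, iterDerivTerm, Function.iterate_succ_apply', realize_derivTerm]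
    rfl

/-! ### Parametric polynomials -/

section Parametric

variable {α : Type u} {ℓ : ℕ}

/-- Specialising the parameters in an integer polynomial in parameters and variables. -/
def specialize {R : Type v} [CommRing R] (v : α → R) :
    MvPolynomial (α ⊕ Fin ℓ) ℤ →+* MvPolynomial (Fin ℓ) R :=
  (MvPolynomial.aeval (Sum.elim (fun a => MvPolynomial.C (v a)) MvPolynomial.X) :
    MvPolynomial (α ⊕ Fin ℓ) ℤ →ₐ[ℤ] MvPolynomial (Fin ℓ) R)

theorem eval_specialize {R : Type v} [CommRing R] (v : α → R) (y : Fin ℓ → R)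
    (p : MvPolynomial (α ⊕ Fin ℓ) ℤ) :
    MvPolynomial.eval y (specialize v p) = MvPolynomial.aeval (Sum.elim v y) p := by
  have : (MvPolynomial.eval y).comp (specialize (ℓ := ℓ) v) =
      (MvPolynomial.aeval (Sum.elim v y) : MvPolynomial (α ⊕ Fin ℓ) ℤ →ₐ[ℤ] R) := by
    refine MvPolynomial.ringHom_ext (fun c => by simp [specialize]) fun i => ?_
    cases i <;> simp [specialize]
  exact congrArg (fun f => f p) this

theorem map_specialize {R : Type v} {S : Type w} [CommRing R] [CommRing S] (φ : R →+* S) (v : α → R)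
    (p : MvPolynomial (α ⊕ Fin ℓ) ℤ) :
    MvPolynomial.map φ (specialize v p) = specialize (φ ∘ v) p := by
  have : (MvPolynomial.map φ).comp (specialize (ℓ := ℓ) v) = specialize (φ ∘ v) := by
    refine MvPolynomial.ringHom_ext (fun c => by simp [specialize]) fun i => ?_
    cases i <;> simp [specialize]
  exact congrArg (fun f => f p) this

theorem specialize_surjective (R : Type v) [CommRing R] :
    Function.Surjective (specialize (ℓ := ℓ) (id : R → R)) := by
  intro p
  induction p using MvPolynomial.induction_on with
  | C c => exact ⟨MvPolynomial.X (.inl c), by simp [specialize]⟩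
  | add p q hp hq =>
    obtain ⟨p, rfl⟩ := hp
    obtain ⟨q, rfl⟩ := hq
    exact ⟨p + q, map_add _ _ _⟩
  | mul_X p i hp =>
    obtain ⟨p, rfl⟩ := hp
    exact ⟨p * MvPolynomial.X (.inr i), by simp [specialize]⟩

theorem eval_specialize_algebraMap {k : Type u} {K : Type w} [Field k] [Field K] [Algebra k K]
    [Differential K] (x : K) (p : MvPolynomial (k ⊕ Fin ℓ) ℤ) :
    MvPolynomial.eval (fun i : Fin ℓ => iterDeriv i x) (specialize (algebraMap k K) p) =
      evalJet k x ℓ (specialize id p) := by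
  rw [← Function.comp_id (algebraMap k K), ← map_specialize, MvPolynomial.eval_map]
  rfl

/-- The terms that evaluate parameters to themselves and variables to the jet of `x`. -/
def jetTerms : α ⊕ Fin ℓ → diffRing.Term (α ⊕ Fin 1) :=
  Sum.elim (fun a => .var (.inl a)) fun i => iterDerivTerm i (.var (.inr 0))

/-- The formula saying that `x` is a zero of the parametric differential polynomial `p`, of order
less than `ℓ`. -/
def isZeroFormula (p : MvPolynomial (α ⊕ Fin ℓ) ℤ) : diffRing.Formula (α ⊕ Fin 1) :=
  (polyTerm jetTerms p).equal 0

/-- The formula saying that `x` is a zero of the parametric differential polynomial `f`, of order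
`ℓ`, where the variable of `f` as a polynomial in one variable stands for `δ^ℓ x`. -/
def isRootFormula (f : Polynomial (MvPolynomial (α ⊕ Fin ℓ) ℤ)) : diffRing.Formula (α ⊕ Fin 1) :=
  (polyTermAt jetTerms (iterDerivTerm ℓ (.var (.inr 0))) f).equal 0

variable {K : Type w} [Field K] [Differential K] [CompatibleDiffRing K]

theorem realize_jetTerms (v : α → K) (x : Fin 1 → K) :
    (fun b : α ⊕ Fin ℓ => (jetTerms b).realize (Sum.elim v x)) =
      Sum.elim v fun i : Fin ℓ => iterDeriv i (x 0) := by
  funext b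
  cases b with
  | inl a => rfl
  | inr i => exact realize_iterDerivTerm _ _ _

theorem realize_isZeroFormula (v : α → K) (x : Fin 1 → K) (p : MvPolynomial (α ⊕ Fin ℓ) ℤ) :
    (isZeroFormula p).Realize (Sum.elim v x) ↔
      MvPolynomial.eval (fun i : Fin ℓ => iterDeriv i (x 0)) (specialize v p) = 0 := by
  rw [isZeroFormula, Formula.realize_equal, realize_polyTerm, realize_zero, realize_jetTerms,
    eval_specialize]

theorem realize_isRootFormula (v : α → K) (x : Fin 1 → K)
    (f : Polynomial (MvPolynomial (α ⊕ Fin ℓ) ℤ)) :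
    (isRootFormula f).Realize (Sum.elim v x) ↔
      ((f.map (specialize v)).map (MvPolynomial.eval fun i : Fin ℓ => iterDeriv i (x 0))).eval
        (iterDeriv ℓ (x 0)) = 0 := by
  rw [isRootFormula, Formula.realize_equal, realize_polyTermAt, realize_zero, realize_jetTerms,
    realize_iterDerivTerm, Polynomial.map_map, Polynomial.eval_map]
  have : ((MvPolynomial.eval fun i : Fin ℓ => iterDeriv i (x 0)).comp (specialize v)) =
      ((MvPolynomial.aeval (Sum.elim v fun i : Fin ℓ => iterDeriv i (x 0)) :
        MvPolynomial (α ⊕ Fin ℓ) ℤ →ₐ[ℤ] K) : MvPolynomial (α ⊕ Fin ℓ) ℤ →+* K) :=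
    RingHom.ext fun p => eval_specialize v _ p
  rw [this]
  rfl

variable {k : Type u} [Field k] [Algebra k K]

theorem realize_isZeroFormula_algebraMap (x : Fin 1 → K) (p : MvPolynomial (k ⊕ Fin ℓ) ℤ) :
    (isZeroFormula p).Realize (Sum.elim (algebraMap k K) x) ↔
      evalJet k (x 0) ℓ (specialize id p) = 0 := by
  rw [realize_isZeroFormula, eval_specialize_algebraMap]

theorem realize_isRootFormula_algebraMap (x : Fin 1 → K)
    (f : Polynomial (MvPolynomial (k ⊕ Fin ℓ) ℤ)) :
    (isRootFormula f).Realize (Sum.elim (algebraMap k K) x) ↔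
      ((f.map (specialize id)).map (evalJet k (x 0) ℓ : MvPolynomial (Fin ℓ) k →+* K)).eval
        (iterDeriv ℓ (x 0)) = 0 := by
  rw [realize_isRootFormula, Polynomial.map_map, Polynomial.map_map,
    show (MvPolynomial.eval fun i : Fin ℓ => iterDeriv i (x 0)).comp
      (specialize (algebraMap k K)) = (evalJet k (x 0) ℓ : MvPolynomial (Fin ℓ) k →+* K).comp
        (specialize id) from RingHom.ext (eval_specialize_algebraMap (x 0))]

end Parametric

/-! ### Blum's axioms -/

/-- The universal closure of a formula with arbitrarily many free variables. -/
def allClosure {L : FirstOrder.Language.{u, v}} {α : Type w} (φ : L.Formula α) : L.Sentence :=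
  open Classical in (φ.not.exClosure).not

theorem realize_allClosure {L : FirstOrder.Language.{u, v}} {α : Type w} (φ : L.Formula α)
    (M : Type*) [L.Structure M] [Nonempty M] :
    M ⊨ allClosure φ ↔ ∀ v : α → M, φ.Realize v := by
  classical
  rw [allClosure, Sentence.Realize, Formula.realize_not, ← not_exists_not, not_iff_not]
  refine (Formula.realize_exClosure _).trans ⟨fun ⟨v, hv⟩ => ?_, fun ⟨v, hv⟩ => ?_⟩
  · refine ⟨fun a => if h : a ∈ φ.not.freeVarFinset then v ⟨a, h⟩ else Classical.arbitrary M, ?_⟩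
    rw [← Formula.realize_not]
    refine (BoundedFormula.realize_restrictFreeVar _ fun a => ?_).1 hv
    rw [dif_pos a.2]
    rfl
  · refine ⟨fun a => v a, ?_⟩
    rw [← Formula.realize_not] at hv
    exact (BoundedFormula.realize_restrictFreeVar (f := id) v fun a => rfl).2 hv

/-- The derivation of a domain extends to its field of fractions. -/
theorem exists_differential_fractionRing (R : Type u) [CommRing R] [Differential R] :
    ∃ _ : Differential (FractionRing R), DifferentialAlgebra R (FractionRing R) := by
  have : Algebra.FormallyEtale R (FractionRing R) := .of_isLocalization (nonZeroDivisors R)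
  obtain ⟨D, hD⟩ := exists_derivation_extension (L := FractionRing R)
    ((algebraMap R (FractionRing R) : R →+ FractionRing R).comp
      (Differential.deriv : Derivation ℤ R R).toLinearMap.toAddMonoidHom) (fun p q => by
        simp [Algebra.smul_def])
  let _ : Differential (FractionRing R) := ⟨D⟩
  exact ⟨⟨D⟩, ⟨hD⟩⟩

theorem isLiteral_equal {L : FirstOrder.Language.{u, v}} {α : Type w} (s t : L.Term α) :
    IsLiteral (s.equal t) :=
  .inl (.equal _ _)

theorem isLiteral_not_equal {L : FirstOrder.Language.{u, v}} {α : Type w} (s t : L.Term α) :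
    IsLiteral (s.equal t).not :=
  .inr ⟨_, .equal _ _, rfl⟩

/-- An existentially closed differential domain is a field: the equation `m x = 1` is solvable in
the field of fractions. -/
theorem isField_of_isExistentiallyClosed (M : Type u) [CommRing M] [IsDomain M] [CharZero M]
    [Differential M] [CompatibleDiffRing M] (h : IsExistentiallyClosed diffDomain M) :
    IsField M := by
  refine ⟨exists_pair_ne M, mul_comm, fun {m} hm => ?_⟩
  obtain ⟨D, hD⟩ := exists_differential_fractionRing M
  let C := compatibleDiffRing (FractionRing M)
  have : CharZero (FractionRing M) := IsFractionRing.charZero M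
  have hinj : Function.Injective (algebraMap M (FractionRing M)) := IsFractionRing.injective _ _
  let φ : diffRing.Formula (M ⊕ Fin 1) :=
    Term.equal (.var (.inl m) * .var (.inr 0) : diffRing.Term (M ⊕ Fin 1)) 1
  obtain ⟨x, hx⟩ := h.2 (FractionRing M) (models_diffDomain _)
    (embeddingOfRingHom _ hD.deriv_algebraMap hinj) 1 {φ} (by simp [φ, isLiteral_equal])
    ⟨fun _ => (algebraMap M (FractionRing M) m)⁻¹, by
      simp only [Finset.mem_singleton, forall_eq, φ, Formula.realize_equal, realize_mul,
        realize_one, Term.realize_var, Sum.elim_inl, Sum.elim_inr]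
      exact mul_inv_cancel₀ ((map_ne_zero_iff _ hinj).2 hm)⟩
  refine ⟨x 0, ?_⟩
  simpa only [φ, Formula.realize_equal, realize_mul, realize_one, Term.realize_var, Sum.elim_inl,
    Sum.elim_inr, id_eq] using hx φ (Finset.mem_singleton_self φ)

/-- Blum's axioms: if `f` is a differential polynomial of order `ℓ` and `q` a nonzero one of order
less than `ℓ`, then `f` has a zero that is not a zero of `q`. Here `f` is written as a polynomial in
`δ^ℓ x` whose coefficients are polynomials in the lower derivatives. -/
def IsBlum (K : Type u) [Field K] [Differential K] : Prop :=
  ∀ (ℓ : ℕ) (f : Polynomial (MvPolynomial (Fin ℓ) K)) (q : MvPolynomial (Fin ℓ) K),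
    0 < f.natDegree → q ≠ 0 → ∃ x : K,
      (f.map (MvPolynomial.eval fun i : Fin ℓ => iterDeriv i x)).eval (iterDeriv ℓ x) = 0 ∧
      MvPolynomial.eval (fun i : Fin ℓ => iterDeriv i x) q ≠ 0

/-- Over every differential field, the system in Blum's axiom has a solution in an extension, namely
the generic zero of an irreducible factor of `f`. -/
theorem exists_extension_blum (K : Type u) [Field K] [CharZero K] [Differential K] {ℓ : ℕ}
    (f : Polynomial (MvPolynomial (Fin ℓ) K)) (q : MvPolynomial (Fin ℓ) K)
    (hf : 0 < f.natDegree) (hq : q ≠ 0) :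
    ∃ (L : Type u) (_ : Field L) (_ : Differential L) (_ : Algebra K L)
      (_ : DifferentialAlgebra K L) (x : L),
      (f.map (evalJet K x ℓ : MvPolynomial (Fin ℓ) K →+* L)).eval (iterDeriv ℓ x) = 0 ∧
      evalJet K x ℓ q ≠ 0 := by
  have hunit : ¬ IsUnit (genericPoly f) := fun h => by
    have := Polynomial.natDegree_eq_zero_of_isUnit h
    rw [genericPoly, Polynomial.natDegree_map_eq_of_injective (IsFractionRing.injective _ _)]
      at this
    omega
  have h0 : genericPoly f ≠ 0 := by
    rw [genericPoly, Polynomial.map_ne_zero_iff (IsFractionRing.injective _ _)]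
    rintro rfl
    simp at hf
  obtain ⟨p, hp, hpf⟩ := WfDvdMonoid.exists_irreducible_factor hunit h0
  obtain ⟨g, c, hc, hg⟩ := exists_map_eq_C_mul (A := MvPolynomial (Fin ℓ) K) p
  have hcu : IsUnit (Polynomial.C c) := Polynomial.isUnit_C.2 hc.isUnit
  have hgirr : Irreducible (genericPoly g) := by
    rw [genericPoly, hg, irreducible_isUnit_mul hcu]
    exact hp
  obtain ⟨s, hs⟩ : genericPoly g ∣ genericPoly f := by
    rw [genericPoly, hg]
    exact hcu.mul_left_dvd.2 hpf
  obtain ⟨L, _, _, _, _, x, ⟨hind, -, hroot⟩, -⟩ := exists_generic_datum hgirr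
  refine ⟨L, inferInstance, inferInstance, inferInstance, inferInstance, x, ?_, ?_⟩
  · rw [← map_jetEquiv hind, hs, Polynomial.map_mul, Polynomial.map_mul, map_jetEquiv,
      Polynomial.eval_mul, hroot, zero_mul]
  · exact (map_ne_zero_iff _ (algebraicIndependent_iff_injective_aeval.1 hind)).2 hq

/-- A polynomial over `R` is a parametric integer polynomial whose parameters, indexed by `R`
itself, are given their own values. -/
theorem exists_map_specialize_id {R : Type u} [CommRing R] {ℓ : ℕ}
    (f : Polynomial (MvPolynomial (Fin ℓ) R)) :
    ∃ f' : Polynomial (MvPolynomial (R ⊕ Fin ℓ) ℤ),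
      f'.map (specialize id) = f ∧ f'.natDegree = f.natDegree :=
  Polynomial.exists_natDegree_eq_of_mem_lifts
    (Polynomial.mem_lifts_of_surjective (specialize_surjective R) f)

theorem isBlum_of_isExistentiallyClosed (K : Type u) [Field K] [CharZero K] [Differential K]
    [CompatibleDiffRing K] (h : IsExistentiallyClosed diffDomain K) : IsBlum K := by
  classical
  intro ℓ f q hf hq
  obtain ⟨L, _, _, _, hKL, y, hfy, hqy⟩ := exists_extension_blum K f q hf hq
  let C := compatibleDiffRing L
  have : CharZero L := charZero_of_injective_algebraMap (algebraMap K L).injective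
  obtain ⟨f', rfl, -⟩ := exists_map_specialize_id f
  obtain ⟨q', rfl⟩ := specialize_surjective K q
  obtain ⟨x, hx⟩ := h.2 L (models_diffDomain L)
    (embeddingOfRingHom _ hKL.deriv_algebraMap (algebraMap K L).injective) 1
    {isRootFormula f', (isZeroFormula q').not}
    (by simp [isRootFormula, isZeroFormula, isLiteral_equal, isLiteral_not_equal])
    ⟨fun _ => y, by
      simp only [Finset.mem_insert, Finset.mem_singleton, forall_eq_or_imp, forall_eq,
        Formula.realize_not]
      exact ⟨(realize_isRootFormula_algebraMap (fun _ => y) f').2 hfy,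
        (realize_isZeroFormula_algebraMap (fun _ => y) q').not.2 hqy⟩⟩
  refine ⟨x 0, (realize_isRootFormula id x f').1 (hx _ (by simp)),
    (realize_isZeroFormula id x q').not.1 ?_⟩
  exact hx (isZeroFormula q').not (by simp)

/-- The formula, in the parameters of `f` and `q`, expressing Blum's axiom. That `f` has full degree
and `q ≠ 0` is expressed by a point where the leading coefficient of `f` and `q` do not vanish; such
a point exists because the field is infinite. -/
def blumFormula {α : Type u} {ℓ : ℕ} (f : Polynomial (MvPolynomial (α ⊕ Fin ℓ) ℤ))
    (q : MvPolynomial (α ⊕ Fin ℓ) ℤ) : diffRing.Formula α :=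
  (Formula.iExs (Fin ℓ) ((polyTerm Term.var (f.leadingCoeff * q)).equal 0).not).imp
    (Formula.iExs (Fin 1) (isRootFormula f ⊓ (isZeroFormula q).not))

theorem realize_blumFormula {α : Type u} {ℓ : ℕ} {K : Type w} [Field K] [Differential K]
    [CompatibleDiffRing K] (f : Polynomial (MvPolynomial (α ⊕ Fin ℓ) ℤ))
    (q : MvPolynomial (α ⊕ Fin ℓ) ℤ) (v : α → K) :
    (blumFormula f q).Realize v ↔
      ((∃ y : Fin ℓ → K, MvPolynomial.eval y (specialize v (f.leadingCoeff * q)) ≠ 0) → ∃ x : K,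
        ((f.map (specialize v)).map (MvPolynomial.eval fun i : Fin ℓ => iterDeriv i x)).eval
          (iterDeriv ℓ x) = 0 ∧
        MvPolynomial.eval (fun i : Fin ℓ => iterDeriv i x) (specialize v q) ≠ 0) := by
  rw [blumFormula, Formula.realize_imp, Formula.realize_iExs, Formula.realize_iExs]
  refine imp_congr (exists_congr fun y => ?_) ⟨fun ⟨x, hx⟩ => ⟨x 0, ?_⟩, fun ⟨x, hx⟩ =>
    ⟨fun _ => x, ?_⟩⟩
  · rw [Formula.realize_not, Formula.realize_equal, realize_polyTerm, realize_zero,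
      eval_specialize]
    rfl
  · rw [Formula.realize_inf, Formula.realize_not] at hx
    exact ⟨(realize_isRootFormula v x f).1 hx.1, (realize_isZeroFormula v x q).not.1 hx.2⟩
  · rw [Formula.realize_inf, Formula.realize_not]
    exact ⟨(realize_isRootFormula v _ f).2 hx.1, (realize_isZeroFormula v _ q).not.2 hx.2⟩

theorem IsBlum.realize_blumFormula {α : Type u} {ℓ : ℕ} {K : Type w} [Field K] [Differential K]
    [CompatibleDiffRing K] (hK : IsBlum K) (f : Polynomial (MvPolynomial (α ⊕ Fin ℓ) ℤ))
    (hf : 0 < f.natDegree) (q : MvPolynomial (α ⊕ Fin ℓ) ℤ) (v : α → K) :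
    (blumFormula f q).Realize v := by
  rw [DCF.realize_blumFormula]
  rintro ⟨y, hy⟩
  rw [map_mul, map_mul] at hy
  have hlead : specialize v f.leadingCoeff ≠ 0 := fun h => hy (by rw [h, map_zero, zero_mul])
  refine hK ℓ _ _ ?_ fun h => hy (by rw [h, map_zero, mul_zero])
  rwa [Polynomial.natDegree_map_of_leadingCoeff_ne_zero _ hlead]

theorem isBlum_of_realize_blumFormula {K : Type u} [Field K] [CharZero K] [Differential K]
    [CompatibleDiffRing K]
    (h : ∀ (ℓ : ℕ) (f : Polynomial (MvPolynomial (K ⊕ Fin ℓ) ℤ)) (q : MvPolynomial (K ⊕ Fin ℓ) ℤ),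
      0 < f.natDegree → (blumFormula f q).Realize (id : K → K)) : IsBlum K := by
  intro ℓ f q hf hq
  obtain ⟨f', rfl, hdeg⟩ := exists_map_specialize_id f
  obtain ⟨q', rfl⟩ := specialize_surjective K q
  refine (realize_blumFormula f' q' id).1 (h ℓ f' q' (hdeg ▸ hf)) ?_
  by_contra! hall
  -- A polynomial over an infinite field that vanishes everywhere is zero.
  have h0 : specialize (id : K → K) (f'.leadingCoeff * q') = 0 :=
    MvPolynomial.funext fun y => by rw [hall, map_zero]
  rw [map_mul, mul_eq_zero, or_iff_left hq, Polynomial.leadingCoeff, ← Polynomial.coeff_map, hdeg,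
    Polynomial.coeff_natDegree, Polynomial.leadingCoeff_eq_zero] at h0
  rw [h0] at hf
  simp at hf

/-- Every nonzero element has an inverse. -/
def inverseSentence : diffRing.Sentence :=
  ∀' ((&0 =' (0 : diffRing.Term _)) ⊔ ∃' ((&0 * &1) =' (1 : diffRing.Term _)))

theorem realize_inverseSentence (R : Type u) [CommRing R] [Differential R] [CompatibleDiffRing R] :
    R ⊨ inverseSentence ↔ ∀ x : R, x = 0 ∨ ∃ y, x * y = 1 := by
  simp [inverseSentence, Sentence.Realize, Formula.Realize, Fin.snoc]

/-- The models of `DCF₀`, in any universe, are differential fields of characteristic zero satisfying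
Blum's axioms. -/
theorem exists_field_of_model (M : Type u) [S : diffRing.Structure M] (h : M ⊨ DCF0) :
    ∃ (_ : Field M) (_ : Differential M) (C : CompatibleDiffRing M),
      C.toStructure = S ∧ CharZero M ∧ IsBlum M := by
  have hT : M ⊨ diffDomain := ⟨fun φ hφ =>
    h.realize_of_mem φ fun N _ hN => hN.1.realize_of_mem φ hφ⟩
  obtain ⟨R, D, C, rfl, hdom, hchar⟩ := exists_diffRing_of_model M hT
  have hinv : M ⊨ inverseSentence := h.realize_of_mem _ fun N S hN => by
    obtain ⟨R, D, C, rfl, hdom, hchar⟩ := exists_diffRing_of_model N hN.1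
    rw [realize_inverseSentence]
    intro x
    by_cases hx : x = 0
    · exact .inl hx
    · exact .inr ((isField_of_isExistentiallyClosed N hN).mul_inv_cancel hx)
  rw [realize_inverseSentence] at hinv
  have hfield : IsField M := ⟨exists_pair_ne M, mul_comm, fun {x} hx => (hinv x).resolve_left hx⟩
  let F : Field M := hfield.toField
  refine ⟨F, D, C, rfl, hchar, ?_⟩
  -- Blum's axioms hold in `M` because their universal closures belong to `DCF0`.
  refine isBlum_of_realize_blumFormula fun ℓ f q hf => ?_
  refine (realize_allClosure (blumFormula f q) M).1 (h.realize_of_mem _ fun N S hN => ?_) id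
  obtain ⟨R, D, C, rfl, hdom, hchar⟩ := exists_diffRing_of_model N hN.1
  let F : Field N := (isField_of_isExistentiallyClosed N hN).toField
  exact (realize_allClosure _ N).2 fun v =>
    (isBlum_of_isExistentiallyClosed N hN).realize_blumFormula f hf q v

/-! ### Tuples with the same atomic formulas -/

/-- The tuples `v` and `v'`, possibly in different structures, satisfy the same atomic formulas. -/
def SameAtomic {α : Type w} {K : Type u} {K' : Type v} [diffRing.Structure K]
    [diffRing.Structure K'] (v : α → K) (v' : α → K') : Prop :=
  ∀ s t : diffRing.Term α, s.realize v = t.realize v ↔ s.realize v' = t.realize v'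

theorem SameAtomic.symm {α : Type w} {K : Type u} {K' : Type v} [diffRing.Structure K]
    [diffRing.Structure K'] {v : α → K} {v' : α → K'} (h : SameAtomic v v') : SameAtomic v' v :=
  fun s t => (h s t).symm

theorem SameAtomic.comp {α : Type w} {β : Type*} {K : Type u} {K' : Type v} [diffRing.Structure K]
    [diffRing.Structure K'] {v : α → K} {v' : α → K'} (h : SameAtomic v v') (g : β → α) :
    SameAtomic (v ∘ g) (v' ∘ g) := fun s t => by
  simpa only [Term.realize_relabel] using h (s.relabel g) (t.relabel g)

theorem sameAtomic_of_ringHom {α : Type*} {L : Type u} {K : Type v} {K' : Type w} [Field L]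
    [Differential L] [Field K] [Differential K] [CompatibleDiffRing K] [Field K'] [Differential K']
    [CompatibleDiffRing K'] (σ : L →+* K)
    (hσ : ∀ y, Differential.deriv (σ y) = σ (Differential.deriv y)) (σ' : L →+* K')
    (hσ' : ∀ y, Differential.deriv (σ' y) = σ' (Differential.deriv y)) (c : α → L) :
    SameAtomic (σ ∘ c) (σ' ∘ c) := fun s t => by
  let C := compatibleDiffRing L
  rw [realize_ringHom σ hσ, realize_ringHom σ hσ, realize_ringHom σ' hσ', realize_ringHom σ' hσ',
    σ.injective.eq_iff, σ'.injective.eq_iff]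

instance : Countable (Σ n, diffRing.Functions n) := by
  refine Function.Injective.countable (β := ℕ × Bool × Bool) (f := fun f => match f with
    | ⟨_, .zero⟩ => (0, true, true)
    | ⟨_, .one⟩ => (1, true, true)
    | ⟨_, .neg⟩ => (2, true, true)
    | ⟨_, .deriv⟩ => (3, true, true)
    | ⟨_, .add⟩ => (4, true, true)
    | ⟨_, .mul⟩ => (5, true, true)) ?_
  rintro ⟨_, f⟩ ⟨_, g⟩ h
  cases f <;> cases g <;> first | rfl | simp at h

theorem countable_term (α : Type w) [Countable α] : Countable (diffRing.Term α) := by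
  rw [← Cardinal.mk_le_aleph0_iff]
  refine Term.card_le.trans (max_le le_rfl ?_)
  exact Cardinal.mk_le_aleph0

/-- The differential field generated by a tuple depends only on the atomic formulas satisfied by the
tuple: it maps to every field with a tuple satisfying the same ones. -/
theorem exists_generated_field {α : Type w} {K : Type u} [Field K] [Differential K]
    [CompatibleDiffRing K] (v : α → K) :
    ∃ (k : Type u) (_ : Field k) (_ : Differential k) (c : α → k),
      (Countable α → Countable k) ∧
      ∀ (K' : Type u) [Field K'] [Differential K'] [CompatibleDiffRing K'] (v' : α → K'),
        SameAtomic v v' → ∃ φ : k →+* K',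
          (∀ y, Differential.deriv (φ y) = φ (Differential.deriv y)) ∧ φ ∘ c = v' := by
  -- `k` is the field of fractions of the ring of values of terms.
  let R : Subring K :=
    { carrier := Set.range fun t : diffRing.Term α => t.realize v
      mul_mem' := by
        rintro _ _ ⟨s, rfl⟩ ⟨t, rfl⟩
        exact ⟨s * t, realize_mul v s t⟩
      one_mem' := ⟨1, realize_one v⟩
      add_mem' := by
        rintro _ _ ⟨s, rfl⟩ ⟨t, rfl⟩
        exact ⟨s + t, realize_add v s t⟩
      zero_mem' := ⟨0, realize_zero v⟩
      neg_mem' := by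
        rintro _ ⟨t, rfl⟩
        exact ⟨-t, realize_neg v t⟩ }
  let elt (t : diffRing.Term α) : R := ⟨t.realize v, t, rfl⟩
  have helt : Function.Surjective elt := by
    rintro ⟨_, t, rfl⟩
    exact ⟨t, rfl⟩
  have hderiv : ∀ r : R, Differential.deriv (r : K) ∈ R := by
    rintro ⟨_, t, rfl⟩
    exact ⟨derivTerm t, realize_derivTerm v t⟩
  let D : Differential R := ⟨Derivation.mk'
    (AddMonoidHom.mk' (fun r : R => (⟨Differential.deriv (r : K), hderiv r⟩ : R))
      fun r s => Subtype.ext (by simp)).toIntLinearMap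
    fun r s => Subtype.ext (Derivation.leibniz Differential.deriv (r : K) (s : K))⟩
  obtain ⟨D', hD'⟩ := exists_differential_fractionRing R
  refine ⟨FractionRing R, inferInstance, D', fun a => algebraMap R _ (elt (.var a)),
    fun hα => ?_, fun K' _ _ _ v' h => ?_⟩
  · have := countable_term α
    have : Countable R := helt.countable
    refine Function.Surjective.countable (α := R × nonZeroDivisors R)
      (f := fun x => IsLocalization.mk' _ x.1 x.2) fun z => ?_
    obtain ⟨x, y, h⟩ := IsLocalization.exists_mk'_eq (nonZeroDivisors R) z
    exact ⟨(x, y), h⟩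
  · have hinv : ∀ s t, elt s = elt t ↔ s.realize v' = t.realize v' := fun s t =>
      Subtype.ext_iff.trans (h s t)
    let φ (r : R) : K' := (Function.surjInv helt r).realize v'
    have hφ : ∀ t, φ (elt t) = t.realize v' := fun t =>
      (hinv _ _).1 (Function.surjInv_eq helt (elt t))
    let ψ : R →+* K' :=
      { toFun := φ
        map_one' := by
          rw [show (1 : R) = elt 1 from Subtype.ext (realize_one v).symm, hφ, realize_one]
        map_zero' := by
          rw [show (0 : R) = elt 0 from Subtype.ext (realize_zero v).symm, hφ, realize_zero]
        map_mul' := fun a b => by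
          obtain ⟨s, rfl⟩ := helt a
          obtain ⟨t, rfl⟩ := helt b
          rw [show elt s * elt t = elt (s * t) from Subtype.ext (realize_mul v s t).symm, hφ, hφ,
            hφ, realize_mul]
        map_add' := fun a b => by
          obtain ⟨s, rfl⟩ := helt a
          obtain ⟨t, rfl⟩ := helt b
          rw [show elt s + elt t = elt (s + t) from Subtype.ext (realize_add v s t).symm, hφ, hφ,
            hφ, realize_add] }
    have hψ : ∀ t, ψ (elt t) = t.realize v' := hφ
    have hinj : Function.Injective ψ := by
      intro a b hab
      obtain ⟨s, rfl⟩ := helt a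
      obtain ⟨t, rfl⟩ := helt b
      rwa [hψ, hψ, ← hinv] at hab
    have : Algebra.FormallyEtale R (FractionRing R) := .of_isLocalization (nonZeroDivisors R)
    have hlift : ∀ r, IsFractionRing.lift (K := FractionRing R) hinj (algebraMap R _ r) = ψ r :=
      fun r => IsFractionRing.lift_algebraMap hinj r
    refine ⟨IsFractionRing.lift hinj, deriv_ringHom_of_formallyUnramified (A := R) _ fun r => ?_,
      funext fun a => (hlift _).trans (hψ _)⟩
    rw [hD'.deriv_algebraMap, hlift, hlift]
    obtain ⟨t, rfl⟩ := helt r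
    rw [show Differential.deriv (elt t) = elt (derivTerm t) from
      Subtype.ext (realize_derivTerm v t).symm, hψ, hψ, realize_derivTerm]

/-! ### Codes of one-types -/

section Code

variable (k : Type u) [Field k]

/-- The possible isomorphism types of a differential field extension of `k` with one generator:
`none` for a differential transcendental, otherwise a minimal polynomial datum. -/
abbrev Code : Type u := Option (Σ ℓ : ℕ, Polynomial (MvPolynomial (Fin ℓ) k))

variable {k} in
/-- The element `x` has the given code over `k`. -/
def HasCode {K : Type v} [Field K] [Algebra k K] [Differential K] (x : K) : Code k → Prop
  | none => AlgebraicIndependent k fun n : ℕ => iterDeriv n x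
  | some d => HasDatum k x d.1 d.2

theorem exists_hasCode {K : Type v} [Field K] [Algebra k K] [Differential K] (x : K) :
    ∃ d : Code k, HasCode x d := by
  by_cases h : AlgebraicIndependent k fun n : ℕ => iterDeriv n x
  · exact ⟨none, h⟩
  · obtain ⟨ℓ, g, hg⟩ := exists_hasDatum h
    exact ⟨some ⟨ℓ, g⟩, hg⟩

variable {k}

/-- Elements with the same code generate isomorphic extensions, since both extensions contain the
generic one. -/
theorem sameAtomic_of_hasCode [Differential k] [CharZero k] {K K' : Type u} [Field K]
    [Differential K] [CompatibleDiffRing K] [Algebra k K] [DifferentialAlgebra k K] [Field K']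
    [Differential K'] [CompatibleDiffRing K'] [Algebra k K'] [DifferentialAlgebra k K'] {x : K}
    {x' : K'} {d : Code k} (hx : HasCode x d) (hx' : HasCode x' d) :
    SameAtomic (Sum.elim (algebraMap k K) fun _ : Fin 1 => x)
      (Sum.elim (algebraMap k K') fun _ : Fin 1 => x') := by
  have key : ∀ (L : Type u) [Field L] [Differential L] [Algebra k L] (x₀ : L),
      EmbedsInto k L x₀ (fun _ _ _ _ y => HasCode y d) →
      SameAtomic (Sum.elim (algebraMap k K) fun _ : Fin 1 => x)
        (Sum.elim (algebraMap k K') fun _ : Fin 1 => x') := by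
    intro L _ _ _ x₀ hL
    obtain ⟨σ, hσ, rfl⟩ := hL K x hx
    obtain ⟨σ', hσ', rfl⟩ := hL K' x' hx'
    convert sameAtomic_of_ringHom σ.toRingHom hσ σ'.toRingHom hσ'
      (Sum.elim (algebraMap k L) fun _ : Fin 1 => x₀) using 1
    · funext i
      cases i
      · exact (σ.commutes _).symm
      · rfl
    · funext i
      cases i
      · exact (σ'.commutes _).symm
      · rfl
  cases d with
  | none =>
    obtain ⟨L, _, _, _, _, x₀, hL⟩ := exists_generic_transcendental k
    exact key L x₀ hL
  | some d =>
    obtain ⟨L, _, _, _, _, x₀, -, hL⟩ := exists_generic_datum hx.2.1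
    exact key L x₀ hL

end Code

/-! ### Elementary extensions realising types -/

/-- A finitely satisfiable set of formulas in one variable, with parameters, is satisfied in an
elementary extension, namely an ultrapower. -/
theorem exists_elementary_extension {L : FirstOrder.Language.{0, 0}} {M : Type u} [L.Structure M]
    [Nonempty M] {α : Type u} (v : α → M) (Γ : Set (L.Formula (α ⊕ Fin 1)))
    (h : ∀ s : Finset (L.Formula (α ⊕ Fin 1)), ↑s ⊆ Γ →
      ∃ y : M, ∀ φ ∈ s, φ.Realize (Sum.elim v fun _ => y)) :
    ∃ (N : Type u) (_ : L.Structure N) (f : M ↪ₑ[L] N) (y : N),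
      ∀ φ ∈ Γ, φ.Realize (Sum.elim (f ∘ v) fun _ => y) := by
  classical
  -- The index set consists of the finite subsets of `Γ`, each with a solution `y s`.
  choose y hy using fun s : Finset Γ => h (s.map (Function.Embedding.subtype _)) (by simp)
  let U : Ultrafilter (Finset Γ) := Ultrafilter.of Filter.atTop
  let cast : (Finset Γ → M) → (U : Filter (Finset Γ)).Product fun _ => M :=
    @Quotient.mk' _ ((U : Filter (Finset Γ)).productSetoid fun _ => M)
  let f : M ↪ₑ[L] (U : Filter (Finset Γ)).Product fun _ => M :=
    { toFun := fun m => cast fun _ => m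
      map_formula' := fun n φ x =>
        (Ultraproduct.realize_formula_cast φ fun i _ => x i).trans Filter.eventually_const }
  refine ⟨_, inferInstance, f, cast y, fun φ hφ => ?_⟩
  have hcast : (Sum.elim (f ∘ v) fun _ => cast y) = fun i => cast
      ((Sum.elim (fun a _ => v a) fun _ => y : α ⊕ Fin 1 → Finset Γ → M) i) := by
    funext i
    cases i <;> rfl
  rw [hcast]
  refine (Ultraproduct.realize_formula_cast φ _).2 ?_
  refine Ultrafilter.of_le _ ?_
  filter_upwards [Filter.eventually_ge_atTop ({⟨φ, hφ⟩} : Finset Γ)] with s hs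
  convert hy s φ (by simpa [hφ] using hs) using 1
  funext i
  cases i <;> rfl

/-- The ring homomorphism underlying an embedding of structures. -/
def ringHomOfEmbedding {R : Type u} {S : Type v} [CommRing R] [Differential R]
    [CompatibleDiffRing R] [CommRing S] [Differential S] [CompatibleDiffRing S]
    (f : R ↪[diffRing] S) : R →+* S where
  toFun := f
  map_one' := by
    have := f.map_fun oneFunc Fin.elim0
    rwa [CompatibleDiffRing.funMap_one, CompatibleDiffRing.funMap_one] at this
  map_zero' := by
    have := f.map_fun zeroFunc Fin.elim0
    rwa [CompatibleDiffRing.funMap_zero, CompatibleDiffRing.funMap_zero] at this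
  map_mul' x y := by
    have := f.map_fun mulFunc ![x, y]
    rwa [CompatibleDiffRing.funMap_mul, CompatibleDiffRing.funMap_mul] at this
  map_add' x y := by
    have := f.map_fun addFunc ![x, y]
    rwa [CompatibleDiffRing.funMap_add, CompatibleDiffRing.funMap_add] at this

theorem deriv_ringHomOfEmbedding {R : Type u} {S : Type v} [CommRing R] [Differential R]
    [CompatibleDiffRing R] [CommRing S] [Differential S] [CompatibleDiffRing S]
    (f : R ↪[diffRing] S) (x : R) :
    Differential.deriv (ringHomOfEmbedding f x) = ringHomOfEmbedding f (Differential.deriv x) := by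
  have := f.map_fun derivFunc ![x]
  rw [CompatibleDiffRing.funMap_deriv, CompatibleDiffRing.funMap_deriv] at this
  exact this.symm

section Satisfiability

variable {k : Type u} [Field k]

theorem IsBlum.exists_of_algebra {K : Type u} [Field K] [Differential K] [Algebra k K]
    (hK : IsBlum K) {ℓ : ℕ} {f : Polynomial (MvPolynomial (Fin ℓ) k)}
    {q : MvPolynomial (Fin ℓ) k} (hf : 0 < f.natDegree) (hq : q ≠ 0) :
    ∃ x : K, (f.map (evalJet k x ℓ : MvPolynomial (Fin ℓ) k →+* K)).eval (iterDeriv ℓ x) = 0 ∧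
      evalJet k x ℓ q ≠ 0 := by
  have hinj := MvPolynomial.map_injective (σ := Fin ℓ) _ (algebraMap k K).injective
  obtain ⟨x, hx, hx'⟩ := hK ℓ (f.map (MvPolynomial.map (algebraMap k K)))
    (MvPolynomial.map (algebraMap k K) q)
    (by rwa [Polynomial.natDegree_map_eq_of_injective hinj])
    ((map_ne_zero_iff _ hinj).2 hq)
  have heval : ∀ p : MvPolynomial (Fin ℓ) k,
      MvPolynomial.eval (fun i : Fin ℓ => iterDeriv i x) (MvPolynomial.map (algebraMap k K) p) =
        evalJet k x ℓ p := fun p => by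
    rw [MvPolynomial.eval_map]
    rfl
  refine ⟨x, ?_, by rwa [heval] at hx'⟩
  rw [Polynomial.map_map] at hx
  rw [← hx]
  congr 2
  exact (RingHom.ext heval).symm

/-- The code of an element, as a set of formulas with parameters in `k`. -/
def codeFormulas : Code k → Set (diffRing.Formula (k ⊕ Fin 1))
  | none => {φ | ∃ (ℓ : ℕ) (p : MvPolynomial (k ⊕ Fin ℓ) ℤ),
      specialize id p ≠ 0 ∧ φ = (isZeroFormula p).not}
  | some ⟨ℓ, g⟩ =>
      {φ | ∃ p : MvPolynomial (k ⊕ Fin ℓ) ℤ, specialize id p ≠ 0 ∧ φ = (isZeroFormula p).not} ∪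
      {φ | ∃ f : Polynomial (MvPolynomial (k ⊕ Fin ℓ) ℤ),
        f.map (specialize id) = g ∧ φ = isRootFormula f}

variable {K : Type u} [Field K] [Differential K] [CompatibleDiffRing K] [Algebra k K]

/-- In a differential field satisfying Blum's axioms, the formulas of a code are finitely
satisfiable: finitely many inequations amount to one, for their product. -/
theorem codeFormulas_finitely_satisfiable (hK : IsBlum K) (d : Code k)
    (hd : ∀ e, d = some e → Irreducible (genericPoly e.2))
    (s : Finset (diffRing.Formula (k ⊕ Fin 1))) (hs : ↑s ⊆ codeFormulas d) :
    ∃ y : K, ∀ φ ∈ s, φ.Realize (Sum.elim (algebraMap k K) fun _ => y) := by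
  classical
  cases d with
  | none =>
    -- The inequations may have different orders, so they are compared at a common larger order.
    have hgen : ∃ ℓ₀, ∀ ℓ ≥ ℓ₀, ∃ q : MvPolynomial (Fin ℓ) k, q ≠ 0 ∧ ∀ y : K,
        evalJet k y ℓ q ≠ 0 →
          ∀ φ ∈ s, φ.Realize (Sum.elim (algebraMap k K) fun _ => y) := by
      induction s using Finset.induction_on with
      | empty => exact ⟨0, fun ℓ _ => ⟨1, one_ne_zero, by simp⟩⟩
      | insert φ s _ ih =>
        rw [Finset.coe_insert, Set.insert_subset_iff] at hs
        obtain ⟨ℓ₀, h₀⟩ := ih hs.2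
        obtain ⟨ℓ₁, p, hp, rfl⟩ := hs.1
        refine ⟨max ℓ₀ ℓ₁, fun ℓ hℓ => ?_⟩
        obtain ⟨q, hq, hq'⟩ := h₀ ℓ (le_of_max_le_left hℓ)
        have hle := le_of_max_le_right hℓ
        refine ⟨q * MvPolynomial.rename (Fin.castLE hle) (specialize id p),
          mul_ne_zero hq ?_, fun y hy => ?_⟩
        · exact (map_ne_zero_iff _
            (MvPolynomial.rename_injective _ (Fin.castLE_injective hle))).2 hp
        · rw [map_mul] at hy
          refine Finset.forall_mem_insert _ _ _ |>.2 ⟨?_, hq' y (left_ne_zero_of_mul hy)⟩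
          refine (realize_isZeroFormula_algebraMap (fun _ => y) p).not.2 ?_
          have := right_ne_zero_of_mul hy
          rwa [MvPolynomial.aeval_rename] at this
    obtain ⟨ℓ, hℓ⟩ := hgen
    obtain ⟨q, hq, hq'⟩ := hℓ ℓ le_rfl
    -- Any equation of order `ℓ` serves, for instance `δ^ℓ y = 0`.
    obtain ⟨y, -, hy⟩ := hK.exists_of_algebra (f := Polynomial.X) (by simp) hq
    exact ⟨y, hq' y hy⟩
  | some d =>
    obtain ⟨ℓ, g⟩ := d
    have hgen : ∃ q : MvPolynomial (Fin ℓ) k, q ≠ 0 ∧ ∀ y : K,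
        (g.map (evalJet k y ℓ : MvPolynomial (Fin ℓ) k →+* K)).eval (iterDeriv ℓ y) = 0 →
        evalJet k y ℓ q ≠ 0 →
          ∀ φ ∈ s, φ.Realize (Sum.elim (algebraMap k K) fun _ => y) := by
      induction s using Finset.induction_on with
      | empty => exact ⟨1, one_ne_zero, by simp⟩
      | insert φ s _ ih =>
        rw [Finset.coe_insert, Set.insert_subset_iff] at hs
        obtain ⟨q, hq, hq'⟩ := ih hs.2
        rcases hs.1 with ⟨p, hp, rfl⟩ | ⟨f, hf, rfl⟩
        · refine ⟨q * specialize id p, mul_ne_zero hq hp, fun y hg hy => ?_⟩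
          rw [map_mul] at hy
          refine Finset.forall_mem_insert _ _ _ |>.2 ⟨?_, hq' y hg (left_ne_zero_of_mul hy)⟩
          exact (realize_isZeroFormula_algebraMap (fun _ => y) p).not.2 (right_ne_zero_of_mul hy)
        · refine ⟨q, hq, fun y hg hy => Finset.forall_mem_insert _ _ _ |>.2 ⟨?_, hq' y hg hy⟩⟩
          exact (realize_isRootFormula_algebraMap (fun _ => y) f).2 (hf ▸ hg)
    obtain ⟨q, hq, hq'⟩ := hgen
    have hdeg : 0 < g.natDegree := by
      rw [← Polynomial.natDegree_map_eq_of_injective (IsFractionRing.injective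
        (MvPolynomial (Fin ℓ) k) (FractionRing (MvPolynomial (Fin ℓ) k)))]
      exact (hd _ rfl).natDegree_pos
    obtain ⟨y, hy, hy'⟩ := hK.exists_of_algebra (f := g) hdeg hq
    exact ⟨y, hq' y hy hy'⟩

theorem hasCode_of_realize_codeFormulas {d : Code k}
    (hd : ∀ e, d = some e → Irreducible (genericPoly e.2)) {y : K}
    (h : ∀ φ ∈ codeFormulas d, φ.Realize (Sum.elim (algebraMap k K) fun _ => y)) :
    HasCode y d := by
  have hind : ∀ ℓ, (∀ p : MvPolynomial (k ⊕ Fin ℓ) ℤ, specialize id p ≠ 0 →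
      (isZeroFormula p).not.Realize (Sum.elim (algebraMap k K) fun _ => y)) →
      JetIndependent k y ℓ := fun ℓ h => by
    refine algebraicIndependent_iff.2 fun p hp => ?_
    obtain ⟨p, rfl⟩ := specialize_surjective k p
    by_contra hne
    exact h p hne ((realize_isZeroFormula_algebraMap (fun _ => y) p).2 hp)
  cases d with
  | none =>
    exact (algebraicIndependent_iff_forall_jetIndependent y).2 fun ℓ =>
      hind ℓ fun p hp => h _ ⟨ℓ, p, hp, rfl⟩
  | some d =>
    obtain ⟨ℓ, g⟩ := d
    refine ⟨hind ℓ fun p hp => h _ (.inl ⟨p, hp, rfl⟩), hd _ rfl, ?_⟩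
    obtain ⟨f, hf, -⟩ := exists_map_specialize_id g
    have := (realize_isRootFormula_algebraMap (fun _ => y) f).1 (h _ (.inr ⟨f, hf, rfl⟩))
    rwa [hf] at this

end Satisfiability

/-! ### Quantifier elimination -/

/-- The extension step of the back-and-forth argument: if `v` and `v'` satisfy the same atomic
formulas, then every `x` has a counterpart in an elementary extension. -/
theorem exists_sameAtomic_extension {α : Type w} {K K' : Type u} [S : diffRing.Structure K]
    [S' : diffRing.Structure K'] (hK : K ⊨ DCF0) (hK' : K' ⊨ DCF0) {v : α → K} {v' : α → K'}
    (h : SameAtomic v v') (x : K) :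
    ∃ (N : Type u) (_ : diffRing.Structure N) (f : K' ↪ₑ[diffRing] N) (y : N),
      SameAtomic (Sum.elim v fun _ : Fin 1 => x) (Sum.elim (f ∘ v') fun _ : Fin 1 => y) := by
  obtain ⟨_, _, C, rfl, _, -⟩ := exists_field_of_model K hK
  obtain ⟨_, _, C', rfl, _, hB⟩ := exists_field_of_model K' hK'
  obtain ⟨k, _, _, c, -, huniv⟩ := exists_generated_field v
  obtain ⟨φ, hφ, rfl⟩ := huniv K v fun _ _ => Iff.rfl
  obtain ⟨φ', hφ', rfl⟩ := huniv K' v' h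
  let _ : Algebra k K := φ.toAlgebra
  let _ : Algebra k K' := φ'.toAlgebra
  have : DifferentialAlgebra k K := ⟨hφ⟩
  have : CharZero k := φ.charZero
  obtain ⟨d, hd⟩ := exists_hasCode k x
  have hirr : ∀ e, d = some e → Irreducible (genericPoly e.2) := by
    rintro e rfl
    exact hd.2.1
  obtain ⟨N, SN, f, y, hy⟩ := exists_elementary_extension (algebraMap k K') (codeFormulas d)
    (codeFormulas_finitely_satisfiable hB d hirr)
  refine ⟨N, SN, f, y, ?_⟩
  obtain ⟨_, _, CN, rfl, -, -⟩ := exists_field_of_model N ((f.theory_model_iff DCF0).1 hK')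
  let ψ := ringHomOfEmbedding f.toEmbedding
  have hψ := deriv_ringHomOfEmbedding f.toEmbedding
  let _ : Algebra k N := (ψ.comp φ').toAlgebra
  have : DifferentialAlgebra k N := ⟨fun a => by
    change Differential.deriv (ψ (φ' a)) = ψ (φ' _)
    rw [hψ, hφ']⟩
  have := (sameAtomic_of_hasCode hd (hasCode_of_realize_codeFormulas hirr hy)).comp (Sum.map c id)
  convert this using 1 <;> funext i <;> cases i <;> rfl

/-- Quantifier elimination for `DCF₀`: tuples with the same atomic formulas have the same type. -/
theorem realize_iff_of_sameAtomic {α : Type w} {n : ℕ} (φ : diffRing.BoundedFormula α n)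
    {K K' : Type u} [diffRing.Structure K] [diffRing.Structure K'] (hK : K ⊨ DCF0)
    (hK' : K' ⊨ DCF0) {v : α → K} {v' : α → K'} {x : Fin n → K} {x' : Fin n → K'}
    (h : SameAtomic (Sum.elim v x) (Sum.elim v' x')) : φ.Realize v x ↔ φ.Realize v' x' := by
  induction φ generalizing K K' with
  | falsum => rfl
  | equal s t => exact h s t
  | rel r => exact r.elim
  | imp φ ψ hφ hψ =>
    rw [BoundedFormula.realize_imp, BoundedFormula.realize_imp, hφ hK hK' h, hψ hK hK' h]
  | @all n φ ih =>
    have key : ∀ {K K' : Type u} [diffRing.Structure K] [diffRing.Structure K'] (_ : K ⊨ DCF0)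
        (_ : K' ⊨ DCF0) {v : α → K} {v' : α → K'} {x : Fin n → K} {x' : Fin n → K'},
        SameAtomic (Sum.elim v x) (Sum.elim v' x') →
        φ.all.Realize v' x' → φ.all.Realize v x := by
      intro K K' _ _ hK hK' v v' x x' h hall
      rw [BoundedFormula.realize_all]
      intro a
      obtain ⟨N, SN, f, b, hab⟩ := exists_sameAtomic_extension hK hK' h a
      have hN := (f.map_boundedFormula φ.all v' x').2 hall
      rw [BoundedFormula.realize_all] at hN
      refine (ih hK ((f.theory_model_iff DCF0).1 hK') ?_).2 (hN b)
      convert hab.comp (Sum.elim (fun i => .inl (.inl i))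
        (Fin.snoc (fun i => .inl (.inr i)) (.inr 0) : Fin (n + 1) → (α ⊕ Fin n) ⊕ Fin 1)) using 1
      all_goals
        funext i
        rcases i with i | i
        · rfl
        · refine Fin.lastCases ?_ (fun j => ?_) i <;> simp
    exact ⟨key hK' hK h.symm, key hK hK' h⟩

/-! ### Counting types -/

theorem SameAtomic.realize_formula_iff {α : Type w} {K K' : Type u} [diffRing.Structure K]
    [diffRing.Structure K'] (hK : K ⊨ DCF0) (hK' : K' ⊨ DCF0) {v : α → K} {v' : α → K'}
    (h : SameAtomic v v') (φ : diffRing.Formula α) : φ.Realize v ↔ φ.Realize v' := by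
  refine realize_iff_of_sameAtomic φ hK hK' ?_
  convert h.comp (Sum.elim id Fin.elim0 : α ⊕ Fin 0 → α) using 1 <;>
  · funext i
    rcases i with i | i
    · rfl
    · exact i.elim0

/-- The atomic formulas satisfied by a tuple, each recorded as a pair of terms. -/
def atomicSet {α : Type w} {K : Type u} [diffRing.Structure K] (v : α → K) :
    Set (diffRing.Term α × diffRing.Term α) :=
  {x | x.1.realize v = x.2.realize v}

theorem atomicSet_eq_iff {α : Type w} {K : Type u} {K' : Type v} [diffRing.Structure K]
    [diffRing.Structure K'] {v : α → K} {v' : α → K'} :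
    atomicSet v = atomicSet v' ↔ SameAtomic v v' := by
  rw [Set.ext_iff, Prod.forall]
  rfl

/-- The atomic types of the tuples in models of `DCF₀` whose restriction along `e` has the same
atomic type as `v`. -/
def atomicExtensions {α β : Type u} {M : Type u} [diffRing.Structure M] (v : α → M) (e : α → β) :
    Set (Set (diffRing.Term β × diffRing.Term β)) :=
  {s | ∃ (N : Type u) (_ : diffRing.Structure N) (w : β → N),
    N ⊨ DCF0 ∧ SameAtomic v (w ∘ e) ∧ s = atomicSet w}

theorem countable_code (k : Type u) [Field k] [Countable k] : Countable (Code k) := by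
  have (ℓ : ℕ) : Countable (MvPolynomial (Fin ℓ) k) := by
    rw [← Cardinal.mk_le_aleph0_iff]
    refine (MvPolynomial.cardinalMk_le_max_lift (σ := Fin ℓ) (R := k)).trans ?_
    simp
  have (ℓ : ℕ) : Countable (Polynomial (MvPolynomial (Fin ℓ) k)) := by
    rw [← Cardinal.mk_le_aleph0_iff]
    refine (Polynomial.cardinalMk_le_max (R := MvPolynomial (Fin ℓ) k)).trans ?_
    simp
  infer_instance

/-- A countable tuple extends in only countably many ways by one element, because the extension is
determined by a code over the countable field generated by the tuple. -/
theorem countable_atomicExtensions {α β : Type u} [Countable α] {M : Type u}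
    [S : diffRing.Structure M] (hM : M ⊨ DCF0) (v : α → M) (e : α → β) (b : β)
    (g : β → α ⊕ Fin 1) (hg : ∀ i, Sum.elim e (fun _ => b) (g i) = i) :
    (atomicExtensions v e).Countable := by
  obtain ⟨_, _, C, rfl, _, -⟩ := exists_field_of_model M hM
  obtain ⟨k, _, _, c, hk, huniv⟩ := exists_generated_field v
  obtain ⟨φ₀, -, -⟩ := huniv M v fun _ _ => Iff.rfl
  have : CharZero k := φ₀.charZero
  have := hk inferInstance
  have := countable_code k
  -- The atomic types of the extensions whose new coordinate has code `d`: there is at most one.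
  let T (d : Code k) : Set (Set (diffRing.Term β × diffRing.Term β)) :=
    {s | ∃ (N : Type u) (_ : Field N) (_ : Differential N) (_ : CompatibleDiffRing N)
      (_ : Algebra k N) (_ : DifferentialAlgebra k N) (w : β → N),
      algebraMap k N ∘ c = w ∘ e ∧ HasCode (w b) d ∧ s = atomicSet w}
  have hT : ∀ d, (T d).Countable := fun d => by
    refine Set.Subsingleton.countable ?_
    have hw : ∀ (N : Type u) [Field N] [Algebra k N] (w : β → N),
        algebraMap k N ∘ c = w ∘ e →
        w = (Sum.elim (algebraMap k N) fun _ => w b) ∘ (Sum.map c id ∘ g) := by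
      intro N _ _ w hc
      funext i
      conv_lhs => rw [← hg i]
      rw [Function.comp_apply, Function.comp_apply]
      cases g i with
      | inl j => exact (congrFun hc j).symm
      | inr j => rfl
    rintro _ ⟨N, _, _, _, _, _, w, hc, hd, rfl⟩ _ ⟨N', _, _, _, _, _, w', hc', hd', rfl⟩
    rw [atomicSet_eq_iff, hw N w hc, hw N' w' hc']
    exact (sameAtomic_of_hasCode hd hd').comp _
  refine (Set.countable_iUnion hT).mono ?_
  rintro _ ⟨N, SN, w, hN, hw, rfl⟩
  obtain ⟨_, _, CN, rfl, _, -⟩ := exists_field_of_model N hN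
  obtain ⟨φ, hφ, hφc⟩ := huniv N (w ∘ e) hw
  let _ : Algebra k N := φ.toAlgebra
  have : DifferentialAlgebra k N := ⟨hφ⟩
  obtain ⟨d, hd⟩ := exists_hasCode k (w b)
  exact Set.mem_iUnion.2 ⟨d, N, _, _, CN, _, this, w, hφc, hd, rfl⟩

theorem countable_atomicExtensions_inl {α : Type u} [Countable α] {M : Type u}
    [diffRing.Structure M] (v : α → M) (n : ℕ) :
    (atomicExtensions v (Sum.inl : α → α ⊕ Fin n)).Countable := by
  induction n with
  | zero =>
    refine Set.Subsingleton.countable ?_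
    rintro _ ⟨N, _, w, -, hw, rfl⟩ _ ⟨N', _, w', -, hw', rfl⟩
    rw [atomicSet_eq_iff]
    have h : SameAtomic (w ∘ Sum.inl) (w' ∘ Sum.inl) := fun s t => (hw s t).symm.trans (hw' s t)
    convert h.comp (Sum.elim id Fin.elim0 : α ⊕ Fin 0 → α) using 1 <;>
    · funext i
      rcases i with i | i
      · rfl
      · exact i.elim0
  | succ n ih =>
    let e : α ⊕ Fin n → α ⊕ Fin (n + 1) := Sum.map id Fin.castSucc
    refine (ih.biUnion (t := fun s _ => {s' | ∃ (N : Type u) (_ : diffRing.Structure N)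
      (w : α ⊕ Fin (n + 1) → N), N ⊨ DCF0 ∧ s = atomicSet (w ∘ e) ∧ s' = atomicSet w})
      fun s hs => ?_).mono ?_
    · obtain ⟨N₁, _, w₁, hN₁, -, rfl⟩ := hs
      refine (countable_atomicExtensions hN₁ w₁ e (.inr (Fin.last n))
        (Sum.elim (fun i => .inl (.inl i))
          (Fin.snoc (fun i => .inl (.inr i)) (.inr 0) : Fin (n + 1) → (α ⊕ Fin n) ⊕ Fin 1))
        fun i => ?_).mono ?_
      · rcases i with i | i
        · rfl
        · refine Fin.lastCases ?_ (fun j => ?_) i <;> simp [e]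
      · rintro _ ⟨N, SN, w, hN, hw, rfl⟩
        exact ⟨N, SN, w, hN, atomicSet_eq_iff.1 hw, rfl⟩
    · rintro _ ⟨N, SN, w, hN, hw, rfl⟩
      exact Set.mem_biUnion (x := atomicSet (w ∘ e)) ⟨N, SN, w ∘ e, hN, hw, rfl⟩
        ⟨N, SN, w, hN, rfl, rfl⟩

/-- A complete type over `A` is realised in a model of `DCF₀`. -/
theorem exists_realization {M : Type u} [diffRing.Structure M] [Nonempty M] (hM : M ⊨ DCF0)
    (A : Set M) {n : ℕ} (p : (diffRing[[A]].completeTheory M).CompleteType (Fin n)) :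
    ∃ (N : Type u) (_ : diffRing.Structure N) (w : A ⊕ Fin n → N), N ⊨ DCF0 ∧
      SameAtomic ((↑) : A → M) (w ∘ Sum.inl) ∧
      ∀ ψ, ψ ∈ p ↔
        Formula.Realize (BoundedFormula.constantsVarsEquiv (Formula.equivSentence.symm ψ)) w := by
  obtain ⟨N, b, rfl⟩ := Theory.exists_modelType_is_realized_in _ p
  let S : diffRing.Structure N := (diffRing.lhomWithConstants A).reduct N
  have hcomplete : ∀ φ : diffRing[[A]].Sentence, N ⊨ φ ↔ M ⊨ φ := fun φ =>
    realize_iff_of_model_completeTheory M N φ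
  refine ⟨N, S, Sum.elim (fun a => (diffRing.con a : N)) b, ⟨fun φ hφ => ?_⟩, fun s t => ?_,
    fun ψ => ?_⟩
  · rw [← LHom.realize_onSentence N (diffRing.lhomWithConstants A), hcomplete,
      LHom.realize_onSentence]
    exact hM.realize_of_mem φ hφ
  · have := hcomplete (Formula.equivSentence (s.equal t))
    rw [Formula.realize_equivSentence, Formula.realize_equivSentence, Formula.realize_equal,
      Formula.realize_equal] at this
    exact this.symm
  · rw [Theory.CompleteType.mem_typeOf]
    exact BoundedFormula.realize_constantsVarsEquiv.symm

theorem isOmegaStable_DCF0 : IsOmegaStable.{0, 0, u} DCF0 := by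
  intro M _ hM A hA n
  have : Nonempty M := by
    obtain ⟨_, -⟩ := exists_field_of_model M hM
    exact ⟨0⟩
  have := hA.to_subtype
  choose N SN w hN hw hp using fun p => exists_realization hM A (n := n) p
  have hcount := (countable_atomicExtensions_inl ((↑) : A → M) n).to_subtype
  refine Function.Injective.countable
    (f := fun p => (⟨atomicSet (w p), N p, SN p, w p, hN p, hw p, rfl⟩ :
      atomicExtensions ((↑) : A → M) (Sum.inl : A → A ⊕ Fin n))) fun p q hpq => ?_
  refine SetLike.ext fun ψ => ?_
  rw [hp, hp]
  exact (atomicSet_eq_iff.1 (Subtype.ext_iff.1 hpq)).realize_formula_iff (hN p) (hN q) _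

/-! ### Types of differentially algebraic elements -/

theorem charZero_of_model (K : Type u) [CommRing K] [Differential K] [CompatibleDiffRing K]
    (h : K ⊨ DCF0) : CharZero K := by
  refine charZero_of_inj_zero fun n hn => ?_
  cases n with
  | zero => rfl
  | succ n =>
    have := h.realize_of_mem (DiffDomainAxiom.charZero n).toSentence fun N _ hN =>
      hN.1.realize_of_mem _ ⟨_, rfl⟩
    simp only [DiffDomainAxiom.toSentence, Sentence.Realize, Formula.Realize,
      BoundedFormula.realize_not, BoundedFormula.realize_bdEqual, realize_natTerm,
      realize_zero] at this
    exact absurd hn this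

theorem HasDatum.of_tp_eq {k K K' : Type u} [Field k] [Field K] [Differential K]
    [CompatibleDiffRing K] [Algebra k K] [Field K'] [Differential K'] [CompatibleDiffRing K']
    [Algebra k K'] {a : K} {b : K'} (h : tp k a = tp k b) {ℓ : ℕ}
    {g : Polynomial (MvPolynomial (Fin ℓ) k)} (ha : HasDatum k a ℓ g) : HasDatum k b ℓ g := by
  refine ⟨algebraicIndependent_iff.2 fun p hp => ?_, ha.2.1, ?_⟩
  · obtain ⟨p, rfl⟩ := specialize_surjective k p
    have : isZeroFormula p ∈ tp k a :=
      h ▸ (realize_isZeroFormula_algebraMap (fun _ => b) p).2 hp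
    exact algebraicIndependent_iff.1 ha.1 _
      ((realize_isZeroFormula_algebraMap (fun _ => a) p).1 this)
  · obtain ⟨f, rfl, -⟩ := exists_map_specialize_id g
    have : isRootFormula f ∈ tp k b :=
      h ▸ (realize_isRootFormula_algebraMap (fun _ => a) f).2 ha.2.2
    exact (realize_isRootFormula_algebraMap (fun _ => b) f).1 this

end DCF

end

theorem theorem4 :
    -- DCF₀ is ω-stable
    DCF.IsOmegaStable.{0, 0, u} DCF.DCF0 ∧
    -- the differentially algebraic 1-types over a differential field `k`, realised by elements
    -- `a`, `b` of models `K`, `K'` of DCF₀ that extend `k`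
    ∀ (k K K' : Type u) [Field k] [Differential k]
      [Field K] [Differential K] [DCF.CompatibleDiffRing K] [Algebra k K] [DifferentialAlgebra k K]
      [Field K'] [Differential K'] [DCF.CompatibleDiffRing K'] [Algebra k K']
      [DifferentialAlgebra k K'],
      K ⊨ DCF.DCF0 → K' ⊨ DCF.DCF0 →
      ∀ (a : K) (b : K'), DCF.IsDiffAlgebraic k a →
        (∃ (ℓ : ℕ) (g : Polynomial (MvPolynomial (Fin ℓ) k)), DCF.IsMinimalDatum k a ℓ g) ∧
        ∀ (ℓ : ℕ) (g : Polynomial (MvPolynomial (Fin ℓ) k)), DCF.IsMinimalDatum k a ℓ g →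
          (DCF.IsMinimalDatum k b ℓ g ↔ DCF.tp k a = DCF.tp k b) := by
  refine ⟨DCF.isOmegaStable_DCF0, ?_⟩
  intro k K K' _ _ _ _ _ _ _ _ _ _ _ _ hK hK' a b ha
  simp only [DCF.isMinimalDatum_iff_hasDatum]
  refine ⟨DCF.exists_hasDatum ha, fun ℓ g hg => ⟨fun hb => ?_, fun h => hg.of_tp_eq h⟩⟩
  have := DCF.charZero_of_model K hK
  have : CharZero k := (algebraMap k K).charZero
  exact Set.ext fun φ => (DCF.sameAtomic_of_hasCode (d := some ⟨ℓ, g⟩) hg hb).realize_formula_iff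
    hK hK' φ
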